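/- Let $n\ge 1$ and $M,N\ge 0$ be integers, let $x_0\in\mathbb R^n$, and let $Q$ be a non-degenerate, symmetric, real $n\times n$ matrix. Write $\langle x\rangle=(1+|x|^2)^{1/2}$ and $D=\frac1i\nabla$, and let $\operatorname{sgn}Q$ be the number of positive eigenvalues of $Q$ minus the number of negative ones, counted with multiplicity. For each $\lambda>0$ let $a(\cdot;\lambda):\mathbb R^n\to\mathbb C$ be of class $C^{n+2N+3}$ and of class $C^M$, and suppose that for each $\lambda>0$ and each multi-index $\alpha$ with $|\alpha|\le M$ there is a constant $C_{M,\alpha}(\lambda)>0$ with $$|(\partial^\alpha a)(x-x_0;\lambda)|<C_{M,\alpha}(\lambda)\,\langle x\rangle^{2M-n-1-|\alpha|}\qquad\text{for all }x\in\mathbb R^n.$$ Then, for every $\lambda>0$, the integral $$I(\lambda)=\int_{\mathbb R^n}e^{i\lambda\langle Q(x-x_0),x-x_0\rangle/2}\,a(x;\lambda)\,dx$$ is well-defined as an oscillatory integral: for every Schwartz function $\chi$ with $\chi(0)=1$, the integrals $\int_{\mathbb R^n} e^{i\lambda\langle Q(x-x_0),x-x_0\rangle/2}a(x;\lambda)\chi(\varepsilon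 x)\,dx$, $\varepsilon>0$, converge absolutely and have a limit as $\varepsilon\to0^+$, which does not depend on $\chi$; this limit is $I(\lambda)$. Moreover, for all $\lambda\ge1$, $$I(\lambda)=\Big(\frac{2\pi}{\lambda}\Big)^{n/2}\frac{e^{i\frac\pi4\operatorname{sgn}Q}}{|\det Q|^{1/2}}\sum_{0\le j\le N}\frac{\lambda^{-j}}{j!}\Big(\frac{\langle Q^{-1}D,D\rangle}{2i}\Big)^j a(x_0;\lambda)+R_1(\lambda)+R_2(\lambda),$$ $$|R_1(\lambda)|\le C\lambda^{-\frac n2-N-1}\sum_{|\alpha|\le n+2N+3}\ \sup_{B(x_0,1)}|\partial^\alpha a(\cdot;\lambda)|,\qquad |R_2(\lambda)|\le C\lambda^{-M}\sum_{|\alpha|\le M}\ \sup_{x\in\mathbb R^n}\frac{|(\partial^\alpha a)(x-x_0;\lambda)|}{\langle x\rangle^{2M-n-1-|\alpha|}},$$ where $B(x_0,1)$ is the ball of radius $1$ centered at $x_0$ and $C$ depends only on $n,M,N,Q,x_0$ (not on $\lambda$ or $a$). If, in addition, $\max\{\lceil n/2\rceil+N+1,\,n+1\}\le M\le n+2N+3$,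 then for all $\lambda\ge1$ $$I(\lambda)=\Big(\frac{2\pi}{\lambda}\Big)^{n/2}\frac{e^{i\frac\pi4\operatorname{sgn}Q}}{|\det Q|^{1/2}}\sum_{0\le j\le N}\frac{\lambda^{-j}}{j!}\Big(\frac{\langle Q^{-1}D,D\rangle}{2i}\Big)^j a(x_0;\lambda)+R(\lambda),\qquad |R(\lambda)|\le C\lambda^{-\frac n2-N-1}\sum_{|\alpha|\le n+2N+3}\ \sup_{\mathbb R^n}|\partial^\alpha a(\cdot;\lambda)|,$$ with $C$ depending only on $n,M,N,Q,x_0$ (the right-hand side may be $+\infty$, in which case the bound says nothing). -/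

import Mathlib

open MeasureTheory Filter Topology
open scoped ENNReal SchwartzMap

noncomputable section

namespace StatPhase

/-- Euclidean space of dimension `n`. -/
abbrev E (n : ℕ) := EuclideanSpace ℝ (Fin n)

/-- The Japanese bracket `⟨x⟩ = (1 + |x|²)^{1/2}`. -/
def bracket {n : ℕ} (x : E n) : ℝ := Real.sqrt (1 + ‖x‖ ^ 2)

/-- The partial derivative `∂_j f`. -/
def pderiv {n : ℕ} (j : Fin n) (f : E n → ℂ) : E n → ℂ :=
  fun x => fderiv ℝ f x (EuclideanSpace.single j 1)

/-- The length `|α|` of a multi-index. -/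
def order {n : ℕ} (α : Fin n → ℕ) : ℕ := ∑ j, α j

/-- The derivative `∂^α f = ∂_0^{α_0} ⋯ ∂_{n-1}^{α_{n-1}} f`. -/
def mderiv {n : ℕ} (α : Fin n → ℕ) (f : E n → ℂ) : E n → ℂ :=
  (List.finRange n).foldr (fun j g => (pderiv j)^[α j] g) f

/-- The finite set of multi-indices `α` in dimension `n` with `|α| ≤ K`. -/
def multiIndices (n K : ℕ) : Finset (Fin n → ℕ) :=
  (Fintype.piFinset fun _ : Fin n => Finset.range (K + 1)).filter (fun α => order α ≤ K)

theorem mem_multiIndices {n K : ℕ} (α : Fin n → ℕ) :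
    α ∈ multiIndices n K ↔ order α ≤ K := by
  simp only [multiIndices, Finset.mem_filter, Fintype.mem_piFinset, Finset.mem_range,
    and_iff_right_iff_imp]
  intro h j
  have : α j ≤ order α := Finset.single_le_sum (fun _ _ => Nat.zero_le _) (Finset.mem_univ j)
  omega

/-- The exponent `2M - n - 1 - |α|` of the weights (it may be negative). -/
def wexp {n : ℕ} (M : ℕ) (α : Fin n → ℕ) : ℤ := 2 * (M : ℤ) - (n : ℤ) - 1 - (order α : ℤ)

/-- The operator `D_j = (1/i) ∂_j`. -/
def Dop {n : ℕ} (j : Fin n) (f : E n → ℂ) : E n → ℂ :=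
  fun x => (1 / Complex.I) * pderiv j f x

/-- The operator `⟨A D, D⟩ / (2i)`, where `⟨A D, D⟩ = ∑_j ∑_k A_{jk} D_k D_j`. -/
def quadOp {n : ℕ} (A : Matrix (Fin n) (Fin n) ℝ) (f : E n → ℂ) : E n → ℂ :=
  fun x => (∑ j, ∑ k, (A j k : ℂ) * Dop k (Dop j f) x) / (2 * Complex.I)

theorem isHermitian_of_isSymm {n : ℕ} {Q : Matrix (Fin n) (Fin n) ℝ} (h : Q.IsSymm) :
    Q.IsHermitian := by
  rw [Matrix.IsHermitian, Matrix.conjTranspose_eq_transpose_of_trivial]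
  exact h

/-- `sgn Q`: the number of positive eigenvalues minus the number of negative eigenvalues of a
real symmetric matrix, counted with multiplicity. -/
def sgn {n : ℕ} (Q : Matrix (Fin n) (Fin n) ℝ) (h : Q.IsSymm) : ℤ :=
  (Fintype.card {j : Fin n // 0 < (isHermitian_of_isSymm h).eigenvalues j} : ℤ) -
    (Fintype.card {j : Fin n // (isHermitian_of_isSymm h).eigenvalues j < 0} : ℤ)

/-- The quadratic phase `⟨Q (x - x₀), x - x₀⟩ / 2`. -/
def phase {n : ℕ} (Q : Matrix (Fin n) (Fin n) ℝ) (x₀ x : E n) : ℝ :=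
  (Q.mulVec (WithLp.ofLp (x - x₀)) ⬝ᵥ WithLp.ofLp (x - x₀)) / 2

/-- `I` is the value of `∫ e^{i φ(x)} a(x) dx` as an oscillatory integral: for every Schwartz
function `χ` with `χ(0) = 1` the regularized integrals `∫ e^{i φ(x)} a(x) χ(ε x) dx`, `ε > 0`,
converge absolutely, and they tend to `I` as `ε → 0+`. -/
def IsOscIntegral {n : ℕ} (φ : E n → ℝ) (a : E n → ℂ) (I : ℂ) : Prop :=
  ∀ χ : 𝓢(E n, ℂ), χ 0 = 1 →
    (∀ ε : ℝ, 0 < ε →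
      Integrable (fun x : E n => Complex.exp (Complex.I * (φ x : ℂ)) * a x * χ (ε • x))) ∧
    Tendsto (fun ε : ℝ =>
        ∫ x : E n, Complex.exp (Complex.I * (φ x : ℂ)) * a x * χ (ε • x))
      (𝓝[>] (0 : ℝ)) (𝓝 I)

/-- The regularity and growth conditions on the amplitude at a fixed value of the parameter. -/
structure IsAmplitude {n : ℕ} (M N : ℕ) (x₀ : E n) (a : E n → ℂ) : Prop where
  contDiff_expansion : ContDiff ℝ ((n + 2 * N + 3 : ℕ) : WithTop ℕ∞) a
  contDiff_weight : ContDiff ℝ (M : WithTop ℕ∞) a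
  growth : ∀ α : Fin n → ℕ, order α ≤ M → ∃ c : ℝ, 0 < c ∧
    ∀ x : E n, ‖mderiv α a (x - x₀)‖ < c * bracket x ^ wexp M α

/-- The truncated expansion
`(2π/λ)^{n/2} e^{iπ sgn Q / 4} |det Q|^{-1/2} ∑_{j ≤ N} λ^{-j}/j! (⟨Q⁻¹D, D⟩/(2i))^j a(x₀)`. -/
def expansion {n : ℕ} (Q : Matrix (Fin n) (Fin n) ℝ) (hQ : Q.IsSymm) (N : ℕ) (x₀ : E n)
    (a : E n → ℂ) (lam : ℝ) : ℂ :=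
  (((2 * Real.pi / lam) ^ ((n : ℝ) / 2) : ℝ) : ℂ) *
    (Complex.exp (Complex.I * (Real.pi / 4) * (sgn Q hQ : ℂ)) /
      ((|Q.det| ^ ((1 : ℝ) / 2) : ℝ) : ℂ)) *
    ∑ j ∈ Finset.range (N + 1),
      (((lam : ℂ) ^ j)⁻¹ / (Nat.factorial j : ℂ)) * ((quadOp Q⁻¹)^[j] a) x₀

/-- `∑_{|α| ≤ K} sup_{x ∈ S} |∂^α a(x)|`, in `[0, ∞]`. -/
def supNormSum {n : ℕ} (K : ℕ) (S : Set (E n)) (a : E n → ℂ) : ℝ≥0∞ :=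
  ∑ α ∈ multiIndices n K, ⨆ x ∈ S, ENNReal.ofReal ‖mderiv α a x‖

/-- `∑_{|α| ≤ M} sup_x |∂^α a(x - x₀)| / ⟨x⟩^{2M-n-1-|α|}`, in `[0, ∞]`. -/
def weightedSupNormSum {n : ℕ} (M : ℕ) (x₀ : E n) (a : E n → ℂ) : ℝ≥0∞ :=
  ∑ α ∈ multiIndices n M,
    ⨆ x : E n, ENNReal.ofReal (‖mderiv α a (x - x₀)‖ / bracket x ^ wexp M α)

end StatPhase

end

/-! Translate the stationary point to the origin and split the amplitude `b(y) = a(y + x₀)` with a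
cutoff equal to `1` for `|y| ≤ 1/2` and supported in `|y| ≤ 3/4`.

Far piece. The vector field `Qy/|Qy|²`, smoothed near the origin (`field`), is a symbol of order
`-1`. Integrating by parts along it (`ibpOp`) replaces a symbol of order `m` by `λ⁻¹` times one of
order `m - 2`. After `M` rounds the order `2M - n - 1` has become `-n - 1`, so the integral
converges absolutely and is `O(λ^{-M})`; this is `R₂`. The regularized integrals have the same limit
for every `χ`, because `χ(ε·) - 1` is a symbol of order `1/2` with constants `O(ε^{1/2})`: the same
`M` rounds leave order `-n - 1/2`, still integrable (`tendsto_integral_osc_mul_schwartz`).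

Near piece. Parseval's identity turns `∫ e^{iλ⟨Qy,y⟩/2} f` into a constant times `∫ f̂(ξ)
e^{-2π²i⟨Q⁻¹ξ,ξ⟩/λ} dξ` (`integral_osc_mul_eq`); the constant carries the factor `e^{iπ sgn Q/4}`,
from square roots of purely imaginary numbers. Taylor expansion of the exponential gives the terms
of the expansion by Fourier inversion at `0`. The remainder is at most a multiple of
`λ^{-N-1}|ξ|^{2N+2}|f̂(ξ)|`, and `n + 2N + 3` derivatives of `f` make this integrable
(`exists_stationary_phase`); this is `R₁`.

If `M ≥ n + 1`, all weights are at least `1`, and if `M ≥ n/2 + N + 1`, then `λ^{-M}` is absorbed by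
`λ^{-n/2-N-1}`; the two errors merge. -/

noncomputable section

namespace StatPhase

open scoped FourierTransform

/-! ### Multi-index derivatives and the full iterated derivative -/

/-- The iterated partial derivative along a list of coordinate directions. -/
def listDeriv {n : ℕ} (l : List (Fin n)) (f : E n → ℂ) : E n → ℂ := l.foldr pderiv f

@[simp]
theorem listDeriv_nil {n : ℕ} (f : E n → ℂ) : listDeriv [] f = f := rfl

@[simp]
theorem listDeriv_cons {n : ℕ} (j : Fin n) (l : List (Fin n)) (f : E n → ℂ) :
    listDeriv (j :: l) f = pderiv j (listDeriv l f) := rfl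

theorem contDiff_pderiv {n k : ℕ} {f : E n → ℂ} (j : Fin n)
    (hf : ContDiff ℝ ((k + 1 : ℕ) : WithTop ℕ∞) f) : ContDiff ℝ (k : WithTop ℕ∞) (pderiv j f) := by
  have h : ContDiff ℝ (k : WithTop ℕ∞) (fderiv ℝ f) :=
    hf.fderiv_right (by push_cast; exact le_rfl)
  exact h.clm_apply contDiff_const

theorem contDiff_listDeriv {n : ℕ} {f : E n → ℂ} (l : List (Fin n)) (k : ℕ)
    (hf : ContDiff ℝ ((k + l.length : ℕ) : WithTop ℕ∞) f) :
    ContDiff ℝ (k : WithTop ℕ∞) (listDeriv l f) := by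
  induction l generalizing k with
  | nil => simpa using hf
  | cons j l ih =>
    exact contDiff_pderiv j (ih (k + 1) (by
      rwa [List.length_cons, ← add_assoc, add_right_comm] at hf))

theorem pderiv_comm {n : ℕ} {f : E n → ℂ} (hf : ContDiff ℝ 2 f) (i j : Fin n) :
    pderiv i (pderiv j f) = pderiv j (pderiv i f) := by
  funext x
  have hd : DifferentiableAt ℝ (fderiv ℝ f) x :=
    ((hf.fderiv_right (m := 1) le_rfl).differentiable one_ne_zero) x
  have key (a b : Fin n) : pderiv a (pderiv b f) x =
      fderiv ℝ (fderiv ℝ f) x (EuclideanSpace.single a 1) (EuclideanSpace.single b 1) := by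
    unfold pderiv
    rw [fderiv_clm_apply hd (differentiableAt_const _)]
    simp
  rw [key, key]
  exact (hf.contDiffAt.isSymmSndFDerivAt (by simp)).eq _ _

/-- Adjacent transpositions generate all permutations, and each is an instance of the symmetry of
second derivatives. The regularity required is exactly the number of derivatives taken. -/
theorem listDeriv_perm {n : ℕ} {f : E n → ℂ} {l l' : List (Fin n)} (h : l.Perm l')
    (hf : ContDiff ℝ (l.length : WithTop ℕ∞) f) : listDeriv l f = listDeriv l' f := by
  induction h with
  | nil => rfl
  | cons j _ ih =>
    rw [listDeriv_cons, listDeriv_cons, ih (hf.of_le (by simp))]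
  | swap i j l =>
    simp only [listDeriv_cons]
    refine pderiv_comm (contDiff_listDeriv l 2 (hf.of_le ?_)) _ _
    simp only [List.length_cons]
    exact_mod_cast (by omega)
  | trans h₁ _ ih₁ ih₂ => rw [ih₁ hf, ih₂ (by rwa [← h₁.length_eq])]

theorem mderiv_eq_listDeriv {n : ℕ} (α : Fin n → ℕ) (f : E n → ℂ) :
    mderiv α f =
      listDeriv ((List.finRange n).flatMap fun j => List.replicate (α j) j) f := by
  unfold mderiv
  induction List.finRange n with
  | nil => rfl
  | cons j s ih =>
    rw [List.foldr_cons, ih, List.flatMap_cons]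
    unfold listDeriv
    rw [List.foldr_append]
    generalize List.foldr pderiv f _ = g
    induction α j with
    | zero => rfl
    | succ m ihm => rw [Function.iterate_succ_apply', ihm, List.replicate_succ, List.foldr_cons]

/-- Sorts an arbitrary list of directions into the order built into `mderiv`; the multi-index is the
counting function of the list. -/
theorem perm_flatMap_replicate_count {n : ℕ} (l : List (Fin n)) :
    l.Perm ((List.finRange n).flatMap fun j => List.replicate (l.count j) j) := by
  rw [List.perm_iff_count]
  intro a
  rw [List.count_flatMap]
  have h : (List.count a ∘ fun j => List.replicate (l.count j) j) =
      fun j => if j = a then l.count a else 0 := by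
    funext j
    by_cases hj : j = a
    · simp [hj]
    · simp [hj, List.count_replicate]
  rw [h, ← Fin.sum_univ_def]
  simp

theorem order_count {n : ℕ} (l : List (Fin n)) : order (fun j => l.count j) = l.length := by
  unfold order
  simpa using Multiset.sum_count_eq_card (s := Finset.univ) (m := (l : Multiset (Fin n))) (by simp)

theorem iteratedFDeriv_apply_single {n k : ℕ} {f : E n → ℂ}
    (hf : ContDiff ℝ (k : WithTop ℕ∞) f) (m : Fin k → Fin n) (x : E n) :
    iteratedFDeriv ℝ k f x (fun i => EuclideanSpace.single (m i) 1) =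
      listDeriv (List.ofFn m) f x := by
  induction k generalizing x with
  | zero => simp
  | succ k ih =>
    have hk : ContDiff ℝ (k : WithTop ℕ∞) f := hf.of_le (by exact_mod_cast k.le_succ)
    have hd : DifferentiableAt ℝ (iteratedFDeriv ℝ k f) x :=
      hf.contDiffAt.differentiableAt_iteratedFDeriv (by exact_mod_cast k.lt_succ_self)
    rw [iteratedFDeriv_succ_apply_left, List.ofFn_succ, listDeriv_cons]
    have h := funext (fun y => (ih hk (fun i => m i.succ) y).symm)
    unfold pderiv
    rw [h]
    have := (ContinuousMultilinearMap.apply ℝ (fun _ : Fin k => E n) ℂ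
      (fun i => EuclideanSpace.single (m i.succ) 1)).hasFDerivAt.comp x hd.hasFDerivAt
    have e := this.fderiv
    simp only [Function.comp_def, ContinuousMultilinearMap.apply_apply] at e
    rw [e]
    rfl

/-- Expand every argument in the standard basis; each coordinate is at most the norm of its vector.
-/
theorem norm_le_sum_norm_apply_single {n k : ℕ}
    (A : ContinuousMultilinearMap ℝ (fun _ : Fin k => E n) ℂ) :
    ‖A‖ ≤ ∑ m : Fin k → Fin n, ‖A fun i => EuclideanSpace.single (m i) 1‖ := by
  refine A.opNorm_le_bound (Finset.sum_nonneg fun _ _ => norm_nonneg _) fun v => ?_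
  have hv : v = fun i => ∑ j : Fin n, (v i j) • (EuclideanSpace.single j (1 : ℝ) : E n) := by
    funext i
    ext j
    simp [Pi.single_apply]
  conv_lhs => rw [hv]
  rw [A.map_sum]
  refine (norm_sum_le _ _).trans ?_
  rw [Finset.sum_mul]
  refine Finset.sum_le_sum fun m _ => ?_
  rw [A.map_smul_univ (fun i => v i (m i)), norm_smul, mul_comm, norm_prod]
  gcongr with i
  exact PiLp.norm_apply_le (v i) (m i)

/-- The full derivative of order `k` is controlled by the partial derivatives of order `k`. -/
theorem norm_iteratedFDeriv_le_of_mderiv {n k : ℕ} {f : E n → ℂ}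
    (hf : ContDiff ℝ (k : WithTop ℕ∞) f) {x : E n} {c : ℝ}
    (h : ∀ α : Fin n → ℕ, order α = k → ‖mderiv α f x‖ ≤ c) :
    ‖iteratedFDeriv ℝ k f x‖ ≤ (n : ℝ) ^ k * c := by
  refine (norm_le_sum_norm_apply_single _).trans ?_
  have : ∀ m ∈ (Finset.univ : Finset (Fin k → Fin n)),
      ‖iteratedFDeriv ℝ k f x fun i => EuclideanSpace.single (m i) 1‖ ≤ c := by
    intro m _
    rw [iteratedFDeriv_apply_single hf, listDeriv_perm (perm_flatMap_replicate_count _)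
      (by simpa using hf), ← mderiv_eq_listDeriv]
    exact h _ (by rw [order_count, List.length_ofFn])
  refine (Finset.sum_le_card_nsmul _ _ _ this).trans ?_
  simp

/-! ### The weight `⟨x⟩` -/

theorem one_le_bracket {n : ℕ} (x : E n) : 1 ≤ bracket x := by
  unfold bracket
  rw [Real.one_le_sqrt]
  nlinarith [sq_nonneg ‖x‖]

theorem bracket_pos {n : ℕ} (x : E n) : 0 < bracket x := one_pos.trans_le (one_le_bracket x)

theorem bracket_sq {n : ℕ} (x : E n) : bracket x ^ 2 = 1 + ‖x‖ ^ 2 :=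
  Real.sq_sqrt (by positivity)

theorem norm_le_bracket {n : ℕ} (x : E n) : ‖x‖ ≤ bracket x :=
  Real.le_sqrt_of_sq_le (by linarith)

theorem bracket_le_one_add_norm {n : ℕ} (x : E n) : bracket x ≤ 1 + ‖x‖ :=
  Real.sqrt_le_iff.2 ⟨by positivity, by nlinarith [norm_nonneg x]⟩

theorem bracket_zero {n : ℕ} : bracket (0 : E n) = 1 := by simp [bracket]

/-- Peetre's inequality: it makes symbol classes invariant under translation. -/
theorem bracket_add_le {n : ℕ} (x z : E n) :
    bracket (x + z) ≤ (Real.sqrt 2 * bracket z) * bracket x := by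
  refine Real.sqrt_le_iff.2 ⟨by positivity [bracket_pos z, bracket_pos x], ?_⟩
  rw [mul_pow, mul_pow, Real.sq_sqrt zero_le_two, bracket_sq, bracket_sq]
  have h := norm_add_le x z
  nlinarith [norm_nonneg (x + z), norm_nonneg x, norm_nonneg z, sq_nonneg (‖x‖ - ‖z‖),
    mul_nonneg (sq_nonneg ‖x‖) (sq_nonneg ‖z‖), mul_self_le_mul_self (norm_nonneg _) h]

/-- For negative `s`, apply Peetre's inequality to `x = (x + z) - z`. -/
theorem bracket_add_rpow_le {n : ℕ} (x z : E n) (s : ℝ) :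
    bracket (x + z) ^ s ≤ (Real.sqrt 2 * bracket z) ^ |s| * bracket x ^ s := by
  have hz := bracket_pos z
  have hx := bracket_pos x
  have hxz := bracket_pos (x + z)
  rcases le_total 0 s with hs | hs
  · rw [abs_of_nonneg hs, ← Real.mul_rpow (by positivity) hx.le]
    exact Real.rpow_le_rpow hxz.le (bracket_add_le x z) hs
  · have h : bracket x ≤ (Real.sqrt 2 * bracket z) * bracket (x + z) := by
      have := bracket_add_le (x + z) (-z)
      simpa [bracket] using this
    rw [abs_of_nonpos hs, Real.rpow_neg (by positivity), inv_mul_eq_div, le_div_iff₀ (by positivity),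
      ← Real.mul_rpow hxz.le (by positivity), mul_comm]
    exact Real.rpow_le_rpow_of_nonpos hx h hs

theorem mul_bracket_le_bracket_smul {n : ℕ} {ε : ℝ} (hε : 0 ≤ ε) (hε1 : ε ≤ 1) (x : E n) :
    ε * bracket x ≤ bracket (ε • x) := by
  refine Real.le_sqrt_of_sq_le ?_
  rw [mul_pow, bracket_sq, norm_smul, Real.norm_of_nonneg hε]
  nlinarith

theorem integrable_bracket_rpow {n : ℕ} {m : ℝ} (hm : m < -n) :
    Integrable (fun x : E n => bracket x ^ m) := by
  have h := integrable_rpow_neg_one_add_norm_sq (E := E n) (μ := volume) (r := -m)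
    (by simpa using by linarith)
  refine h.congr (Eventually.of_forall fun x => ?_)
  simp only [bracket, Real.sqrt_eq_rpow]
  rw [← Real.rpow_mul (by positivity)]
  congr 1
  ring

/-! ### Symbol classes with explicit constants -/

/-- `f` is of class `C^k` and satisfies symbol estimates of order `m` with constant `C` up to
order `k`: its `i`-th derivative is at most `C ⟨x⟩^{m-i}`. -/
structure IsSymbol {n : ℕ} (k : ℕ) (m C : ℝ) (f : E n → ℂ) : Prop where
  contDiff : ContDiff ℝ (k : WithTop ℕ∞) f
  bound : ∀ i ≤ k, ∀ x, ‖iteratedFDeriv ℝ i f x‖ ≤ C * bracket x ^ (m - i)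

namespace IsSymbol

variable {n k : ℕ} {m m' C C' : ℝ} {f g : E n → ℂ}

theorem nonneg (hf : IsSymbol k m C f) : 0 ≤ C := by
  have h := hf.bound 0 (Nat.zero_le _) 0
  rw [bracket_zero, Real.one_rpow, mul_one] at h
  exact (norm_nonneg _).trans h

theorem norm_le (hf : IsSymbol k m C f) (x : E n) : ‖f x‖ ≤ C * bracket x ^ m := by
  simpa using hf.bound 0 (Nat.zero_le _) x

theorem mono (hf : IsSymbol k m C f) {k' : ℕ} (hk : k' ≤ k) (hm : m ≤ m') (hC : C ≤ C') :
    IsSymbol k' m' C' f := by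
  refine ⟨hf.contDiff.of_le (by exact_mod_cast hk), fun i hi x =>
    (hf.bound i (hi.trans hk) x).trans ?_⟩
  have := hf.nonneg.trans hC
  have := bracket_pos x
  gcongr
  exact one_le_bracket x

/-- Leibniz' rule: orders add, and the binomial coefficients sum to at most `2 ^ k`. -/
theorem mul (hf : IsSymbol k m C f) (hg : IsSymbol k m' C' g) :
    IsSymbol k (m + m') (2 ^ k * (C * C')) (fun x => f x * g x) := by
  refine ⟨hf.contDiff.mul hg.contDiff, fun i hi x => ?_⟩
  have hb := bracket_pos x
  have hC := hf.nonneg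
  have hC' := hg.nonneg
  refine (norm_iteratedFDeriv_mul_le hf.contDiff hg.contDiff x (by exact_mod_cast hi)).trans ?_
  have h : ∀ j ∈ Finset.range (i + 1),
      (i.choose j : ℝ) * ‖iteratedFDeriv ℝ j f x‖ * ‖iteratedFDeriv ℝ (i - j) g x‖ ≤
        (i.choose j : ℝ) * (C * C' * bracket x ^ (m + m' - i)) := by
    intro j hj
    have hj' : j ≤ i := Nat.lt_succ_iff.1 (Finset.mem_range.1 hj)
    have e : bracket x ^ (m + m' - i) =
        bracket x ^ (m - j) * bracket x ^ (m' - ((i - j : ℕ) : ℝ)) := by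
      rw [← Real.rpow_add hb, Nat.cast_sub hj']
      congr 1
      ring
    rw [e, mul_assoc]
    have h1 := hf.bound j (hj'.trans hi) x
    have h2 := hg.bound (i - j) ((Nat.sub_le _ _).trans hi) x
    calc _ ≤ (i.choose j : ℝ) * ((C * bracket x ^ (m - j)) *
          (C' * bracket x ^ (m' - ((i - j : ℕ) : ℝ)))) := by gcongr
      _ = _ := by ring
  refine (Finset.sum_le_sum h).trans ?_
  rw [← Finset.sum_mul]
  have h2 : (∑ j ∈ Finset.range (i + 1), (i.choose j : ℝ)) = 2 ^ i := by
    exact_mod_cast Nat.sum_range_choose i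
  rw [h2, ← mul_assoc]
  gcongr
  exact one_le_two

theorem pderiv (hf : IsSymbol (k + 1) m C f) (j : Fin n) :
    IsSymbol k (m - 1) C (StatPhase.pderiv j f) := by
  have hd : ContDiff ℝ (k : WithTop ℕ∞) (fderiv ℝ f) :=
    hf.contDiff.fderiv_right (by push_cast; exact le_rfl)
  refine ⟨contDiff_pderiv j hf.contDiff, fun i hi x => ?_⟩
  have h := norm_iteratedFDeriv_clm_apply_const (c := EuclideanSpace.single j (1 : ℝ))
    (hd.contDiffAt (x := x)) (n := i) (by exact_mod_cast hi)
  refine h.trans ?_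
  rw [norm_iteratedFDeriv_fderiv, PiLp.norm_single, norm_one, one_mul]
  refine (hf.bound (i + 1) (by omega) x).trans (le_of_eq ?_)
  push_cast
  congr 2
  ring

theorem const_mul (hf : IsSymbol k m C f) (c : ℂ) :
    IsSymbol k m (‖c‖ * C) (fun x => c * f x) := by
  refine ⟨contDiff_const.mul hf.contDiff, fun i hi x => ?_⟩
  have h := iteratedFDeriv_const_smul_apply (𝕜 := ℝ) (a := c) (i := i)
    ((hf.contDiff.of_le (by exact_mod_cast hi)).contDiffAt (x := x))
  have e : (fun x => c * f x) = c • f := rfl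
  rw [e, h, norm_smul, mul_assoc]
  gcongr
  exact hf.bound i hi x

theorem sum {ι : Type*} {s : Finset ι} {F : ι → E n → ℂ} (hF : ∀ j ∈ s, IsSymbol k m C (F j)) :
    IsSymbol k m (s.card * C) (fun x => ∑ j ∈ s, F j x) := by
  refine ⟨ContDiff.sum fun j hj => (hF j hj).contDiff, fun i hi x => ?_⟩
  rw [iteratedFDeriv_fun_sum_apply fun j hj =>
      ((hF j hj).contDiff.of_le (by exact_mod_cast hi)).contDiffAt,
    mul_assoc]
  refine (norm_sum_le _ _).trans ?_
  simpa using Finset.sum_le_card_nsmul s _ _ fun j hj => (hF j hj).bound i hi x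

/-- Peetre's inequality at each order `m - i`; since `|m - i| ≤ |m| + k`, a single factor,
independent of `f`, serves for all derivatives. -/
theorem comp_add_right (hf : IsSymbol k m C f) (z : E n) :
    IsSymbol k m ((Real.sqrt 2 * bracket z) ^ (|m| + k) * C) (fun x => f (x + z)) := by
  refine ⟨hf.contDiff.comp (contDiff_id.add contDiff_const), fun i hi x => ?_⟩
  rw [iteratedFDeriv_comp_add_right]
  refine (hf.bound i hi _).trans ?_
  have hC := hf.nonneg
  have hx := bracket_pos x
  have h1 : 1 ≤ Real.sqrt 2 * bracket z :=
    one_le_mul_of_one_le_of_one_le (by simp) (one_le_bracket z)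
  rw [mul_right_comm, mul_comm]
  gcongr
  refine (bracket_add_rpow_le x z _).trans ?_
  gcongr
  refine (abs_sub _ _).trans ?_
  rw [Nat.abs_cast]
  gcongr

theorem of_forall_exists (hf : ContDiff ℝ (k : WithTop ℕ∞) f)
    (h : ∀ i ≤ k, ∃ c, ∀ x, ‖iteratedFDeriv ℝ i f x‖ ≤ c * bracket x ^ (m - i)) :
    ∃ C, IsSymbol k m C f := by
  choose! c hc using h
  refine ⟨∑ i ∈ Finset.range (k + 1), |c i|, hf, fun i hi x => (hc i hi x).trans ?_⟩
  have := bracket_pos x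
  gcongr
  exact (le_abs_self _).trans (Finset.single_le_sum (f := fun i => |c i|)
    (fun _ _ => abs_nonneg _) (Finset.mem_range.2 (by omega)))

/-- `⟨εx⟩` and `⟨x⟩` are comparable for fixed `ε`. The constant is not uniform in `ε`; this serves
only to justify integrability and integration by parts before the limit. -/
theorem comp_smul (hf : IsSymbol k m C f) {ε : ℝ} (hε : 0 < ε) :
    ∃ C', IsSymbol k m C' (fun x => f (ε • x)) := by
  refine of_forall_exists (hf.contDiff.comp (contDiff_const_smul ε)) fun i hi =>
    ⟨ε ^ i * (C * (max ε ε⁻¹) ^ |m - i|), fun x => ?_⟩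
  rw [iteratedFDeriv_comp_const_smul ε (hf.contDiff.of_le (by exact_mod_cast hi)), norm_smul,
    norm_pow, Real.norm_of_nonneg hε.le, mul_assoc, mul_assoc]
  have hC := hf.nonneg
  have hx := bracket_pos x
  have hex := bracket_pos (ε • x)
  have hM : 0 < max ε ε⁻¹ := lt_max_of_lt_left hε
  have hM1 : 1 ≤ max ε ε⁻¹ := by
    rcases le_total 1 ε with h | h
    · exact le_max_of_le_left h
    · exact le_max_of_le_right ((one_le_inv₀ hε).2 h)
  gcongr
  refine (hf.bound i hi _).trans ?_
  gcongr
  rcases le_total 0 (m - i) with hs | hs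
  · rw [abs_of_nonneg hs, ← Real.mul_rpow hM.le hx.le]
    refine Real.rpow_le_rpow hex.le ?_ hs
    refine Real.sqrt_le_iff.2 ⟨by positivity, ?_⟩
    rw [mul_pow, bracket_sq, norm_smul, Real.norm_of_nonneg hε.le, mul_pow]
    have h1 : 1 ≤ (max ε ε⁻¹) ^ 2 := one_le_pow₀ hM1
    have h2 : ε ^ 2 ≤ (max ε ε⁻¹) ^ 2 := by gcongr; exact le_max_left _ _
    nlinarith [sq_nonneg ‖x‖]
  · rw [abs_of_nonpos hs, Real.rpow_neg hM.le, inv_mul_eq_div, le_div_iff₀ (by positivity),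
      ← Real.mul_rpow hex.le hM.le]
    refine Real.rpow_le_rpow_of_nonpos hx ?_ hs
    refine Real.sqrt_le_iff.2 ⟨by positivity, ?_⟩
    rw [mul_pow, bracket_sq, norm_smul, Real.norm_of_nonneg hε.le, mul_pow]
    have h1 : 1 ≤ (max ε ε⁻¹) ^ 2 := one_le_pow₀ hM1
    have h2 : (ε⁻¹) ^ 2 ≤ (max ε ε⁻¹) ^ 2 := by gcongr; exact le_max_right _ _
    have h3 : ε ^ 2 * ε⁻¹ ^ 2 = 1 := by rw [← mul_pow, mul_inv_cancel₀ hε.ne', one_pow]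
    nlinarith [sq_nonneg ‖x‖, mul_le_mul_of_nonneg_left h2 (mul_nonneg (sq_nonneg ε) (sq_nonneg ‖x‖))]

theorem integrable_mul (hf : IsSymbol k m C f) (hm : m < -n) {e : E n → ℂ} (he : Continuous e)
    (he1 : ∀ x, ‖e x‖ ≤ 1) : Integrable (fun x => e x * f x) := by
  refine ((integrable_bracket_rpow hm).const_mul C).mono'
    (he.mul hf.contDiff.continuous).aestronglyMeasurable (Eventually.of_forall fun x => ?_)
  rw [norm_mul]
  exact (mul_le_of_le_one_left (norm_nonneg _) (he1 x)).trans (hf.norm_le x)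

theorem norm_integral_mul_le (hf : IsSymbol k m C f) (hm : m < -n) {e : E n → ℂ}
    (he1 : ∀ x, ‖e x‖ ≤ 1) :
    ‖∫ x, e x * f x‖ ≤ C * ∫ x : E n, bracket x ^ m := by
  rw [← integral_const_mul]
  refine norm_integral_le_of_norm_le ((integrable_bracket_rpow hm).const_mul C)
    (Eventually.of_forall fun x => ?_)
  rw [norm_mul]
  exact (mul_le_of_le_one_left (norm_nonneg _) (he1 x)).trans (hf.norm_le x)

end IsSymbol

/-! ### Schwartz regularizers as symbols -/

theorem exists_isSymbol_schwartz {n : ℕ} (χ : 𝓢(E n, ℂ)) (k : ℕ) (m : ℝ) :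
    ∃ C, IsSymbol k m C χ := by
  refine IsSymbol.of_forall_exists (χ.smooth k) fun i hi => ?_
  obtain ⟨p, hp⟩ := exists_nat_ge (-(m - i))
  refine ⟨2 ^ p * (Finset.Iic (p, i)).sup (fun m => SchwartzMap.seminorm ℝ m.1 m.2) χ, fun x => ?_⟩
  have h := SchwartzMap.one_add_le_sup_seminorm_apply (𝕜 := ℝ) (m := (p, i)) le_rfl le_rfl χ x
  have hb := bracket_pos x
  have h1 : bracket x ^ (-(m - i)) ≤ (1 + ‖x‖) ^ p := by
    rw [← Real.rpow_natCast]
    calc bracket x ^ (-(m - i)) ≤ bracket x ^ (p : ℝ) :=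
          Real.rpow_le_rpow_of_exponent_le (one_le_bracket x) hp
      _ ≤ _ := Real.rpow_le_rpow hb.le (bracket_le_one_add_norm x) (Nat.cast_nonneg _)
  have h2 := (mul_le_mul_of_nonneg_right h1 (norm_nonneg (iteratedFDeriv ℝ i χ x))).trans h
  rw [Real.rpow_neg hb.le, inv_mul_eq_div, div_le_iff₀ (by positivity)] at h2
  exact h2

/-- The dilates `χ(ε ·)` of a Schwartz function with `χ(0) = 1` converge to `1` as symbols of order
`1/2`. -/
theorem exists_isSymbol_schwartz_smul_sub_one {n : ℕ} (χ : 𝓢(E n, ℂ)) (hχ : χ 0 = 1) (k : ℕ) :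
    ∃ C, ∀ ε : ℝ, 0 < ε → ε ≤ 1 →
      IsSymbol k (1 / 2) (C * ε ^ (1 / 2 : ℝ)) (fun x => χ (ε • x) - 1) := by
  obtain ⟨A, hA⟩ := exists_isSymbol_schwartz χ (k + 1) (1 / 2)
  obtain ⟨B, hB⟩ := exists_isSymbol_schwartz χ 1 0
  have hA0 := hA.nonneg
  have hB0 := hB.nonneg
  have hχd : Differentiable ℝ χ := χ.differentiable
  -- Hölder control of exponent `1/2` at the origin: the Lipschitz bound for `|z| ≤ 1`, and
  -- boundedness beyond, where `1 = |χ(0)| ≤ B` gives `|χ(z) - 1| ≤ 2B`.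
  have key : ∀ z : E n, ‖χ z - 1‖ ≤ 2 * B * ‖z‖ ^ (1 / 2 : ℝ) := by
    intro z
    have hz := norm_nonneg z
    rcases le_total ‖z‖ 1 with h | h
    · have h1 : ‖χ z - χ 0‖ ≤ B * ‖z - 0‖ := by
        refine Convex.norm_image_sub_le_of_norm_fderiv_le (𝕜 := ℝ) (fun x _ => hχd x)
          (fun x _ => ?_) convex_univ (Set.mem_univ _) (Set.mem_univ _)
        have := hB.bound 1 le_rfl x
        rw [← norm_iteratedFDeriv_one]
        refine this.trans (mul_le_of_le_one_right hB0 ?_)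
        exact Real.rpow_le_one_of_one_le_of_nonpos (one_le_bracket x) (by norm_num)
      rw [hχ, sub_zero] at h1
      have h2 : ‖z‖ ≤ ‖z‖ ^ (1 / 2 : ℝ) := by
        conv_lhs => rw [← Real.rpow_one ‖z‖]
        exact Real.rpow_le_rpow_of_exponent_ge_of_imp hz h (by norm_num) (by norm_num)
      nlinarith [mul_le_mul_of_nonneg_left h2 hB0]
    · have h1 := hB.norm_le z
      have h2 := hB.norm_le 0
      rw [hχ] at h2
      simp only [Real.rpow_zero, mul_one] at h1 h2
      have h3 : 1 ≤ ‖z‖ ^ (1 / 2 : ℝ) := Real.one_le_rpow h (by norm_num)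
      have := norm_sub_le (χ z) 1
      nlinarith [mul_le_mul_of_nonneg_left h3 hB0]
  refine ⟨max A (2 * B), fun ε hε hε1 => ⟨?_, fun i hi x => ?_⟩⟩
  · exact ((χ.smooth k).comp (contDiff_const_smul ε)).sub contDiff_const
  have hx := bracket_pos x
  have hc : ContDiff ℝ (i : WithTop ℕ∞) χ := χ.smooth i
  rcases Nat.eq_zero_or_pos i with rfl | hi0
  · rw [norm_iteratedFDeriv_zero, Nat.cast_zero, sub_zero]
    refine (key _).trans ?_
    rw [norm_smul, Real.norm_of_nonneg hε.le, Real.mul_rpow hε.le (norm_nonneg _), ← mul_assoc]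
    gcongr
    · exact le_max_right _ _
    · exact norm_le_bracket x
  · have e : iteratedFDeriv ℝ i (fun x => χ (ε • x) - 1) x =
        ε ^ i • iteratedFDeriv ℝ i χ (ε • x) := by
      have e1 : (fun x => χ (ε • x) - 1) = (fun x => χ (ε • x)) - fun _ => (1 : ℂ) := rfl
      have hc1 : ContDiff ℝ (i : WithTop ℕ∞) fun x => χ (ε • x) := hc.comp (contDiff_const_smul ε)
      rw [e1, iteratedFDeriv_sub_apply hc1.contDiffAt contDiff_const.contDiffAt,
        iteratedFDeriv_const_of_ne hi0.ne', iteratedFDeriv_comp_const_smul ε hc]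
      simp
    rw [e, norm_smul, norm_pow, Real.norm_of_nonneg hε.le]
    have h1 := hA.bound i (by omega) (ε • x)
    have hi1 : (1 : ℝ) ≤ i := by exact_mod_cast hi0
    -- For `i ≥ 1` the exponent `1/2 - i` is negative, so `ε⟨x⟩ ≤ ⟨εx⟩` helps. The chain-rule factor
    -- `ε ^ i` against `ε ^ (1/2 - i)` leaves exactly `ε ^ (1/2)`.
    have h2 : bracket (ε • x) ^ ((1 / 2 : ℝ) - i) ≤ (ε * bracket x) ^ ((1 / 2 : ℝ) - i) :=
      Real.rpow_le_rpow_of_nonpos (by positivity) (mul_bracket_le_bracket_smul hε.le hε1 x)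
        (by linarith)
    rw [Real.mul_rpow hε.le hx.le] at h2
    have h3 : ε ^ (1 / 2 : ℝ) = ε ^ i * ε ^ ((1 / 2 : ℝ) - i) := by
      rw [← Real.rpow_natCast, ← Real.rpow_add hε]
      congr 1
      ring
    rw [h3]
    calc _ ≤ ε ^ i * (A * (ε ^ ((1 / 2 : ℝ) - i) * bracket x ^ ((1 / 2 : ℝ) - i))) := by
          gcongr
          exact h1.trans (by gcongr)
      _ = A * (ε ^ i * ε ^ ((1 / 2 : ℝ) - i)) * bracket x ^ ((1 / 2 : ℝ) - i) := by ring
      _ ≤ _ := by gcongr; exact le_max_left _ _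

/-- The `i`-th derivative of a function homogeneous of degree `-1` is homogeneous of degree `-1 -
i`, so its size everywhere is governed by a maximum over the compact unit ball. -/
theorem isSymbol_of_homogeneous {n : ℕ} {h : E n → ℂ} (k : ℕ)
    (hh : ContDiff ℝ (k : WithTop ℕ∞) h)
    (hom : ∀ t : ℝ, 1 ≤ t → ∀ y : E n, 1 / 2 < ‖y‖ → h (t • y) = ((t⁻¹ : ℝ) : ℂ) * h y) :
    ∃ C, IsSymbol k (-1) C h := by
  refine IsSymbol.of_forall_exists hh fun i hi => ?_
  have hhi : ContDiff ℝ (i : WithTop ℕ∞) h := hh.of_le (by exact_mod_cast hi)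
  obtain ⟨M, hM⟩ := (isCompact_closedBall (0 : E n) 1).exists_bound_of_continuousOn
    (f := iteratedFDeriv ℝ i h) (hhi.continuous_iteratedFDeriv le_rfl).continuousOn
  have hM0 : 0 ≤ M := (norm_nonneg _).trans (hM 0 (by simp))
  have hbr : ∀ (y : E n) (t : ℝ), 1 ≤ t → ‖y‖ ≤ t →
      t ^ (-1 - (i : ℝ)) ≤ (2 : ℝ) ^ (1 + (i : ℝ)) * bracket y ^ (-1 - (i : ℝ)) := by
    intro y t ht hy
    have hb : bracket y ≤ 2 * t :=
      Real.sqrt_le_iff.2 ⟨by positivity, by nlinarith [norm_nonneg y]⟩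
    have h1 := Real.rpow_le_rpow_of_nonpos (bracket_pos y) hb
      (show -1 - (i : ℝ) ≤ 0 by linarith [Nat.cast_nonneg (α := ℝ) i])
    rw [Real.mul_rpow zero_le_two (by positivity)] at h1
    calc t ^ (-1 - (i : ℝ)) = (2 : ℝ) ^ (1 + (i : ℝ)) *
          ((2 : ℝ) ^ (-1 - (i : ℝ)) * t ^ (-1 - (i : ℝ))) := by
          rw [← mul_assoc, ← Real.rpow_add two_pos]
          norm_num
      _ ≤ _ := by gcongr
  refine ⟨M * 2 ^ (1 + (i : ℝ)), fun y => ?_⟩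
  rw [mul_assoc]
  rcases le_total ‖y‖ 1 with hy | hy
  · have h1 := hbr y 1 le_rfl hy
    rw [Real.one_rpow] at h1
    exact (hM y (by simpa using hy)).trans (le_mul_of_one_le_right hM0 h1)
  · set t := ‖y‖ with ht
    have ht0 : 0 < t := one_pos.trans_le hy
    -- Near `y` the function is a rescaled copy of itself read off near the unit sphere. Homogeneity
    -- from radius `1/2 < 1` on makes this an identity on an open set, which can be differentiated.
    have hev : h =ᶠ[𝓝 y] fun z => ((t⁻¹ : ℝ) : ℂ) • h (t⁻¹ • z) := by
      have hopen : {z : E n | t / 2 < ‖z‖} ∈ 𝓝 y :=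
        (isOpen_lt continuous_const continuous_norm).mem_nhds (by
          change t / 2 < t; linarith)
      filter_upwards [hopen] with z hz
      have := hom t hy (t⁻¹ • z) (by
        rw [norm_smul, norm_inv, Real.norm_of_nonneg ht0.le, inv_mul_eq_div, lt_div_iff₀ ht0]
        change t / 2 < ‖z‖ at hz
        linarith)
      rw [smul_smul, mul_inv_cancel₀ ht0.ne', one_smul] at this
      exact this
    rw [Filter.EventuallyEq.eq_of_nhds (Filter.EventuallyEq.iteratedFDeriv ℝ hev i)]
    have hc : ContDiff ℝ (i : WithTop ℕ∞) fun z => h (t⁻¹ • z) := hhi.comp (contDiff_const_smul _)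
    have e := iteratedFDeriv_const_smul_apply (𝕜 := ℝ) (a := ((t⁻¹ : ℝ) : ℂ)) (i := i)
      (hc.contDiffAt (x := y))
    have e' : (((t⁻¹ : ℝ) : ℂ) • fun z => h (t⁻¹ • z)) =
      fun z => ((t⁻¹ : ℝ) : ℂ) • h (t⁻¹ • z) := rfl
    rw [e'] at e
    rw [e, iteratedFDeriv_comp_const_smul t⁻¹ hhi, norm_smul, norm_smul, norm_pow, norm_inv,
      Complex.norm_real, norm_inv, Real.norm_of_nonneg ht0.le, ← mul_assoc, ← pow_succ']
    have h2 : t⁻¹ ^ (i + 1) = t ^ (-1 - (i : ℝ)) := by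
      rw [inv_pow, ← Real.rpow_natCast, ← Real.rpow_neg ht0.le]
      push_cast
      congr 1
      ring
    rw [h2, mul_comm]
    have h3 : ‖iteratedFDeriv ℝ i h (t⁻¹ • y)‖ ≤ M := hM _ (by
      rw [mem_closedBall_zero_iff, norm_smul, norm_inv, Real.norm_of_nonneg ht0.le,
        inv_mul_cancel₀ ht0.ne'])
    exact mul_le_mul h3 (hbr y t hy le_rfl) (by positivity) hM0

/-! ### The quadratic phase and its transversal vector field -/

/-- The bump function equal to `1` for `|y| ≤ 1/4` and supported in `|y| < 1/2`. -/
def innerBump (n : ℕ) : ContDiffBump (0 : E n) := ⟨1 / 4, 1 / 2, by norm_num, by norm_num⟩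

/-- The gradient `Q y` of the quadratic phase. -/
def grad {n : ℕ} (Q : Matrix (Fin n) (Fin n) ℝ) : E n →L[ℝ] E n :=
  Matrix.toEuclideanCLM (𝕜 := ℝ) Q

theorem grad_ne_zero {n : ℕ} {Q : Matrix (Fin n) (Fin n) ℝ} (hQ : Q.det ≠ 0) {y : E n}
    (hy : y ≠ 0) : grad Q y ≠ 0 := by
  intro h
  have h1 : Q.mulVec (WithLp.ofLp y) = 0 := congrArg WithLp.ofLp h
  exact hy (WithLp.ofLp_injective 2 (Matrix.eq_zero_of_mulVec_eq_zero hQ h1))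

theorem phase_zero_eq {n : ℕ} (Q : Matrix (Fin n) (Fin n) ℝ) (y : E n) :
    phase Q 0 y = inner ℝ y (grad Q y) / 2 := by
  rw [grad, Matrix.inner_toEuclideanCLM, phase, sub_zero, dotProduct_comm]

theorem phase_add_right {n : ℕ} (Q : Matrix (Fin n) (Fin n) ℝ) (x₀ y : E n) :
    phase Q x₀ (y + x₀) = phase Q 0 y := by
  simp [phase]

theorem continuous_phase {n : ℕ} (Q : Matrix (Fin n) (Fin n) ℝ) : Continuous (phase Q 0) := by
  simp_rw [funext (phase_zero_eq Q)]
  fun_prop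

theorem inner_grad_comm {n : ℕ} {Q : Matrix (Fin n) (Fin n) ℝ} (hQ : Q.IsSymm) (x y : E n) :
    inner ℝ x (grad Q y) = inner ℝ y (grad Q x) := by
  rw [grad, Matrix.inner_toEuclideanCLM, Matrix.inner_toEuclideanCLM, Matrix.dotProduct_mulVec,
    ← Matrix.mulVec_transpose, hQ.eq, dotProduct_comm]

/-- The oscillating factor `e^{iλ⟨Qy, y⟩/2}`. -/
def osc {n : ℕ} (Q : Matrix (Fin n) (Fin n) ℝ) (lam : ℝ) (y : E n) : ℂ :=
  Complex.exp (Complex.I * ((lam * phase Q 0 y : ℝ) : ℂ))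

theorem norm_osc {n : ℕ} (Q : Matrix (Fin n) (Fin n) ℝ) (lam : ℝ) (y : E n) :
    ‖osc Q lam y‖ = 1 := by
  rw [osc, mul_comm, Complex.norm_exp_ofReal_mul_I]

theorem continuous_osc {n : ℕ} (Q : Matrix (Fin n) (Fin n) ℝ) (lam : ℝ) :
    Continuous (osc Q lam) := by
  have := continuous_phase Q
  unfold osc
  fun_prop

theorem hasFDerivAt_osc {n : ℕ} {Q : Matrix (Fin n) (Fin n) ℝ} (hQ : Q.IsSymm) (lam : ℝ)
    (y : E n) : DifferentiableAt ℝ (osc Q lam) y ∧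
      ∀ j, pderiv j (osc Q lam) y = Complex.I * lam * (grad Q y j : ℂ) * osc Q lam y := by
  have h1 : HasFDerivAt (fun y : E n => lam * phase Q 0 y)
      (lam • (2⁻¹ : ℝ) • (fderivInnerCLM ℝ (y, grad Q y)).comp
        ((ContinuousLinearMap.id ℝ (E n)).prod (grad Q))) y := by
    have := (((hasFDerivAt_id (𝕜 := ℝ) y).inner ℝ (grad Q).hasFDerivAt).const_mul
      (2⁻¹ : ℝ)).const_mul lam
    refine this.congr_of_eventuallyEq (Eventually.of_forall fun z => ?_)
    simp only [phase_zero_eq, id]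
    ring
  have h2 := ((Complex.ofRealCLM.hasFDerivAt.comp y h1).const_mul Complex.I).cexp
  refine ⟨h2.differentiableAt, fun j => ?_⟩
  have h3 : pderiv j (osc Q lam) y = _ := congrArg (fun A => A (EuclideanSpace.single j 1)) h2.fderiv
  rw [h3]
  have h4 : inner ℝ y (grad Q (EuclideanSpace.single j 1)) = grad Q y j := by
    rw [inner_grad_comm hQ]
    simp [EuclideanSpace.inner_single_left]
  have h5 : inner ℝ (EuclideanSpace.single j (1 : ℝ)) (grad Q y) = grad Q y j := by
    simp [EuclideanSpace.inner_single_left]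
  simp [fderivInnerCLM_apply, h4, h5, osc]
  ring

/-- The `j`-th component of the vector field `θ(y) Qy / |Qy|²`, where `θ` vanishes near the origin
and equals `1` for `|y| ≥ 1/2`. -/
def field {n : ℕ} (Q : Matrix (Fin n) (Fin n) ℝ) (j : Fin n) (y : E n) : ℂ :=
  (((1 - innerBump n y) * (grad Q y j / ‖grad Q y‖ ^ 2) : ℝ) : ℂ)

theorem contDiff_field {n : ℕ} {Q : Matrix (Fin n) (Fin n) ℝ} (hQ : Q.det ≠ 0) (j : Fin n)
    (k : ℕ) : ContDiff ℝ (k : WithTop ℕ∞) (field Q j) := by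
  rw [contDiff_iff_contDiffAt]
  intro y
  rcases eq_or_ne y 0 with rfl | hy
  · have : field Q j =ᶠ[𝓝 (0 : E n)] fun _ => 0 := by
      filter_upwards [(innerBump n).eventuallyEq_one] with z hz
      simp [field, hz]
    exact contDiffAt_const.congr_of_eventuallyEq this
  · refine Complex.ofRealCLM.contDiff.contDiffAt.comp y ?_
    refine ((contDiffAt_const.sub (innerBump n).contDiffAt)).mul (ContDiffAt.div ?_ ?_ ?_)
    · exact ((EuclideanSpace.proj j : E n →L[ℝ] ℝ).comp (grad Q)).contDiff.contDiffAt
    · exact ((grad Q).contDiff.norm_sq ℝ).contDiffAt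
    · exact pow_ne_zero _ (norm_ne_zero_iff.2 (grad_ne_zero hQ hy))

theorem exists_isSymbol_field {n : ℕ} {Q : Matrix (Fin n) (Fin n) ℝ} (hQ : Q.det ≠ 0) (k : ℕ) :
    ∃ C, ∀ j, IsSymbol k (-1) C (field Q j) := by
  have h : ∀ j, ∃ C, IsSymbol k (-1) C (field Q j) := by
    intro j
    refine isSymbol_of_homogeneous k (contDiff_field hQ j k) fun t ht y hy => ?_
    have ht0 : 0 < t := by linarith
    have h1 : innerBump n y = 0 := (innerBump n).zero_of_le_dist (by simpa [innerBump] using hy.le)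
    have h2 : innerBump n (t • y) = 0 := (innerBump n).zero_of_le_dist (by
      rw [dist_zero_right, norm_smul, Real.norm_of_nonneg ht0.le]
      simp only [innerBump]
      nlinarith [norm_nonneg y])
    simp only [field, h1, h2, ← Complex.ofReal_mul]
    congr 1
    rw [map_smul, norm_smul, Real.norm_of_nonneg ht0.le, PiLp.smul_apply, smul_eq_mul]
    field_simp
  choose C hC using h
  exact ⟨∑ j, |C j|, fun j => (hC j).mono le_rfl le_rfl ((le_abs_self _).trans
    (Finset.single_le_sum (f := fun j => |C j|) (fun _ _ => abs_nonneg _) (Finset.mem_univ j)))⟩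

theorem sum_grad_mul_field {n : ℕ} {Q : Matrix (Fin n) (Fin n) ℝ} (hQ : Q.det ≠ 0) {y : E n}
    (hy : 1 / 2 ≤ ‖y‖) : ∑ j, (grad Q y j : ℂ) * field Q j y = 1 := by
  have h1 : innerBump n y = 0 := (innerBump n).zero_of_le_dist (by simpa [innerBump] using hy)
  have h2 : ‖grad Q y‖ ^ 2 ≠ 0 := pow_ne_zero _ (norm_ne_zero_iff.2 (grad_ne_zero hQ (by
    rintro rfl
    norm_num at hy)))
  simp only [field, h1, sub_zero, one_mul, ← Complex.ofReal_mul, ← Complex.ofReal_sum]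
  norm_cast
  simp only [← mul_div_assoc, ← Finset.sum_div]
  rw [div_eq_one_iff_eq h2, EuclideanSpace.norm_sq_eq]
  exact Finset.sum_congr rfl fun j _ => by rw [Real.norm_eq_abs, sq_abs, sq]

/-- The linear growth of `Qy` is exactly offset by the decay of the field, so differentiating the
oscillating factor costs no integrability. -/
theorem norm_grad_mul_field_le {n : ℕ} (Q : Matrix (Fin n) (Fin n) ℝ) (j : Fin n) (y : E n) :
    ‖(grad Q y j : ℂ) * field Q j y‖ ≤ 1 := by
  rw [field, ← Complex.ofReal_mul, Complex.norm_real]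
  have h0 := (innerBump n).nonneg (x := y)
  have h1 := (innerBump n).le_one (x := y)
  have h2 : |grad Q y j| ≤ ‖grad Q y‖ := PiLp.norm_apply_le (grad Q y) j
  have e : grad Q y j * ((1 - innerBump n y) * (grad Q y j / ‖grad Q y‖ ^ 2)) =
      (1 - innerBump n y) * (grad Q y j ^ 2 / ‖grad Q y‖ ^ 2) := by ring
  rw [e, Real.norm_of_nonneg (mul_nonneg (by linarith) (by positivity))]
  refine mul_le_one₀ (by linarith) (by positivity) (div_le_one_of_le₀ ?_ (by positivity))
  rw [← sq_abs]
  gcongr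

/-! ### Integration by parts away from the stationary point -/

/-- The transpose of the first order operator which reproduces `e^{iλ⟨Qy, y⟩/2}` away from the
origin. -/
def ibpOp {n : ℕ} (Q : Matrix (Fin n) (Fin n) ℝ) (lam : ℝ) (g : E n → ℂ) : E n → ℂ :=
  fun y => (Complex.I / lam) * ∑ j, pderiv j (fun z => field Q j z * g z) y

theorem contDiff_ibpOp {n k : ℕ} {Q : Matrix (Fin n) (Fin n) ℝ} (hQ : Q.det ≠ 0) (lam : ℝ)
    {g : E n → ℂ} (hg : ContDiff ℝ ((k + 1 : ℕ) : WithTop ℕ∞) g) :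
    ContDiff ℝ (k : WithTop ℕ∞) (ibpOp Q lam g) :=
  contDiff_const.mul (ContDiff.sum fun j _ =>
    contDiff_pderiv j ((contDiff_field hQ j (k + 1)).mul hg))

theorem ibpOp_sub {n : ℕ} {Q : Matrix (Fin n) (Fin n) ℝ} (hQ : Q.det ≠ 0) (lam : ℝ)
    {g h : E n → ℂ} (hg : ContDiff ℝ 1 g) (hh : ContDiff ℝ 1 h) :
    ibpOp Q lam (fun y => g y - h y) = fun y => ibpOp Q lam g y - ibpOp Q lam h y := by
  funext y
  unfold ibpOp
  rw [← mul_sub, ← Finset.sum_sub_distrib]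
  congr 1
  refine Finset.sum_congr rfl fun j _ => ?_
  have hf : ContDiff ℝ 1 (field Q j) := contDiff_field hQ j 1
  have e : (fun z => field Q j z * (g z - h z)) =
      fun z => field Q j z * g z - field Q j z * h z := by
    funext z
    ring
  unfold pderiv
  rw [e, fderiv_fun_sub ((hf.mul hg).differentiable one_ne_zero y)
    ((hf.mul hh).differentiable one_ne_zero y)]
  rfl

theorem ibpOp_iterate_sub {n k : ℕ} {Q : Matrix (Fin n) (Fin n) ℝ} (hQ : Q.det ≠ 0) (lam : ℝ)
    {g h : E n → ℂ} (hg : ContDiff ℝ (k : WithTop ℕ∞) g) (hh : ContDiff ℝ (k : WithTop ℕ∞) h) :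
    (ibpOp Q lam)^[k] (fun y => g y - h y) =
      fun y => (ibpOp Q lam)^[k] g y - (ibpOp Q lam)^[k] h y := by
  induction k generalizing g h with
  | zero => rfl
  | succ k ih =>
    simp only [Function.iterate_succ_apply]
    rw [ibpOp_sub hQ lam (hg.of_le (by simp)) (hh.of_le (by simp))]
    exact ih (contDiff_ibpOp hQ lam hg) (contDiff_ibpOp hQ lam hh)

/-- Differential operators are local; the vanishing near the origin thus survives each round and the
integration by parts can be repeated. -/
theorem ibpOp_eq_zero {n : ℕ} (Q : Matrix (Fin n) (Fin n) ℝ) (lam : ℝ) {g : E n → ℂ} {r : ℝ}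
    (hg : ∀ y, ‖y‖ < r → g y = 0) (y : E n) (hy : ‖y‖ < r) : ibpOp Q lam g y = 0 := by
  unfold ibpOp
  refine mul_eq_zero_of_right _ (Finset.sum_eq_zero fun j _ => ?_)
  have : (fun z => field Q j z * g z) =ᶠ[𝓝 y] fun _ => 0 := by
    filter_upwards [(isOpen_lt continuous_norm continuous_const).mem_nhds hy] with z hz
    rw [hg z hz, mul_zero]
  unfold pderiv
  rw [this.fderiv_eq]
  simp

/-- Each application of `ibpOp` lowers the order by `2` and gains a factor `λ⁻¹`. -/
theorem exists_isSymbol_ibpOp {n : ℕ} {Q : Matrix (Fin n) (Fin n) ℝ} (hQ : Q.det ≠ 0) (M : ℕ) :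
    ∃ B : ℝ, 0 ≤ B ∧ ∀ lam : ℝ, 0 < lam → ∀ k < M, ∀ (m C : ℝ) (g : E n → ℂ),
      IsSymbol (k + 1) m C g → IsSymbol k (m - 2) (B / lam * C) (ibpOp Q lam g) := by
  obtain ⟨A, hA⟩ := exists_isSymbol_field hQ M
  refine ⟨n * (2 ^ M * |A|), by positivity, fun lam hlam k hk m C g hg => ?_⟩
  have hC := hg.nonneg
  have h1 : ∀ j ∈ (Finset.univ : Finset (Fin n)),
      IsSymbol k (m - 2) (2 ^ M * (|A| * C)) (pderiv j fun z => field Q j z * g z) := by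
    intro j _
    refine ((((hA j).mono hk le_rfl (le_abs_self A)).mul hg).pderiv j).mono le_rfl
      (by linarith) ?_
    gcongr
    · exact one_le_two
    · omega
  have h2 := (IsSymbol.sum h1).const_mul (Complex.I / lam)
  refine h2.mono le_rfl le_rfl (le_of_eq ?_)
  rw [norm_div, Complex.norm_I, Complex.norm_real, Real.norm_of_nonneg hlam.le, Finset.card_univ,
    Fintype.card_fin]
  ring

theorem isSymbol_ibpOp_iterate {n M : ℕ} {Q : Matrix (Fin n) (Fin n) ℝ} {B lam : ℝ}
    (hB : ∀ k < M, ∀ (m C : ℝ) (g : E n → ℂ),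
      IsSymbol (k + 1) m C g → IsSymbol k (m - 2) (B / lam * C) (ibpOp Q lam g))
    {m C : ℝ} {g : E n → ℂ} {k : ℕ} (hk : k ≤ M) (hg : IsSymbol k m C g) :
    IsSymbol 0 (m - 2 * k) ((B / lam) ^ k * C) ((ibpOp Q lam)^[k] g) := by
  induction k generalizing m C g with
  | zero => simpa using hg
  | succ k ih =>
    rw [Function.iterate_succ_apply]
    have := ih (by omega) (hB k (by omega) m C g hg)
    refine this.mono le_rfl (le_of_eq ?_) (le_of_eq ?_)
    · push_cast
      ring
    · ring

/-- Moving `∂_j` onto the oscillating factor produces `-iλ (Qy)_j`. Contraction with the field gives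
`-iλ` where `|y| ≥ 1/2`, cancelled by the prefactor `i/λ`; elsewhere `g` vanishes. -/
theorem integral_osc_mul_ibpOp {n : ℕ} {Q : Matrix (Fin n) (Fin n) ℝ} (hQ : Q.det ≠ 0)
    (hQs : Q.IsSymm) {lam : ℝ} (hlam : lam ≠ 0) {m C : ℝ} {g : E n → ℂ} (hg : IsSymbol 1 m C g)
    (hm : m < -n) (hv : ∀ y, ‖y‖ < 1 / 2 → g y = 0) :
    ∫ y, osc Q lam y * ibpOp Q lam g y = ∫ y, osc Q lam y * g y := by
  have hlam' : (lam : ℂ) ≠ 0 := Complex.ofReal_ne_zero.2 hlam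
  have hosc := continuous_osc Q lam
  obtain ⟨A, hA⟩ := exists_isSymbol_field hQ 1
  have hfc (j : Fin n) : ContDiff ℝ 1 (field Q j) := contDiff_field hQ j 1
  have hs (j : Fin n) : IsSymbol 1 (-1 + m) (2 ^ 1 * (A * C)) (fun z => field Q j z * g z) :=
    (hA j).mul hg
  have hgrad (j : Fin n) : Continuous fun y => (grad Q y j : ℂ) :=
    Complex.continuous_ofReal.comp
      ((EuclideanSpace.proj j : E n →L[ℝ] ℝ).comp (grad Q)).continuous
  have i1 (j : Fin n) : Integrable fun y => osc Q lam y * pderiv j (fun z => field Q j z * g z) y :=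
    ((hs j).pderiv j).integrable_mul (by linarith) hosc fun y => (norm_osc Q lam y).le
  -- The growing factor `(Qy)_j` is grouped with the field, so that the integrability of `g` alone
  -- suffices.
  have i2 (j : Fin n) : Integrable fun y =>
      pderiv j (osc Q lam) y * (field Q j y * g y) := by
    have e : (fun y => pderiv j (osc Q lam) y * (field Q j y * g y)) =
        fun y => Complex.I * lam *
          ((osc Q lam y * ((grad Q y j : ℂ) * field Q j y)) * g y) := by
      funext y
      rw [(hasFDerivAt_osc hQs lam y).2 j]
      ring
    rw [e]
    refine (hg.integrable_mul hm (hosc.mul ((hgrad j).mul (hfc j).continuous))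
      fun y => ?_).const_mul _
    rw [Pi.mul_apply, Pi.mul_apply, norm_mul, norm_osc, one_mul]
    exact norm_grad_mul_field_le Q j y
  have i3 (j : Fin n) : Integrable fun y => osc Q lam y * (field Q j y * g y) :=
    (hs j).integrable_mul (by linarith) hosc fun y => (norm_osc Q lam y).le
  have key (j : Fin n) := integral_mul_fderiv_eq_neg_fderiv_mul_of_integrable
    (i2 j) (i1 j) (i3 j) (fun y _ => (hasFDerivAt_osc hQs lam y).1)
    (fun y _ => (hs j).contDiff.differentiable (by simp) y)
  have e1 : ∫ y, osc Q lam y * ibpOp Q lam g y =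
      (Complex.I / lam) * ∑ j, ∫ y, osc Q lam y * pderiv j (fun z => field Q j z * g z) y := by
    rw [← integral_finsetSum _ fun j _ => i1 j, ← integral_const_mul]
    congr 1
    funext y
    rw [ibpOp, ← Finset.mul_sum]
    ring
  have e2 : ∑ j, ∫ y, osc Q lam y * pderiv j (fun z => field Q j z * g z) y =
      - ∑ j, ∫ y, pderiv j (osc Q lam) y * (field Q j y * g y) := by
    rw [← Finset.sum_neg_distrib]
    exact Finset.sum_congr rfl fun j _ => key j
  rw [e1, e2, ← integral_finsetSum _ fun j _ => i2 j, ← integral_neg, ← integral_const_mul]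
  congr 1
  funext y
  have e3 : ∑ j, pderiv j (osc Q lam) y * (field Q j y * g y) =
      Complex.I * lam * osc Q lam y * (∑ j, (grad Q y j : ℂ) * field Q j y) * g y := by
    rw [Finset.mul_sum, Finset.sum_mul]
    refine Finset.sum_congr rfl fun j _ => ?_
    rw [(hasFDerivAt_osc hQs lam y).2 j]
    ring
  rw [e3]
  rcases lt_or_ge ‖y‖ (1 / 2) with h | h
  · simp [hv y h]
  · rw [sum_grad_mul_field hQ h]
    field_simp
    rw [Complex.I_sq]
    ring

/-- The alternative `k = 0` admits amplitudes that do not vanish at the stationary point, for which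
nothing is integrated by parts. -/
theorem integral_osc_mul_ibpOp_iterate {n : ℕ} {Q : Matrix (Fin n) (Fin n) ℝ} (hQ : Q.det ≠ 0)
    (hQs : Q.IsSymm) {lam : ℝ} (hlam : 0 < lam) {m C : ℝ} {g : E n → ℂ} {k : ℕ}
    (hg : IsSymbol k m C g) (hm : m < -n) (hv : k = 0 ∨ ∀ y, ‖y‖ < 1 / 2 → g y = 0) :
    ∫ y, osc Q lam y * (ibpOp Q lam)^[k] g y = ∫ y, osc Q lam y * g y := by
  rcases hv with rfl | hv
  · rfl
  induction k generalizing m C g with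
  | zero => rfl
  | succ k ih =>
    obtain ⟨B, -, hB⟩ := exists_isSymbol_ibpOp hQ (k + 1)
    rw [Function.iterate_succ_apply,
      ih (hB lam hlam k k.lt_succ_self m C g hg) (by linarith) (ibpOp_eq_zero Q lam hv),
      integral_osc_mul_ibpOp hQ hQs hlam.ne' (hg.mono (by omega) le_rfl le_rfl) hm hv]

/-! ### Convergence and decay of the regularized integrals -/

/-- Regularized oscillatory integrals of symbols of order `2M - n - 1` converge. -/
theorem tendsto_integral_osc_mul_schwartz {n M : ℕ} {Q : Matrix (Fin n) (Fin n) ℝ}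
    (hQ : Q.det ≠ 0) (hQs : Q.IsSymm) {lam : ℝ} (hlam : 0 < lam) {A : ℝ} {g : E n → ℂ}
    (hg : IsSymbol M (2 * M - n - 1) A g) (hv : M = 0 ∨ ∀ y, ‖y‖ < 1 / 2 → g y = 0)
    (z : E n) (χ : 𝓢(E n, ℂ)) (hχ : χ 0 = 1) :
    Tendsto (fun ε : ℝ => ∫ y, osc Q lam y * (g y * χ (ε • (y + z)))) (𝓝[>] 0)
      (𝓝 (∫ y, osc Q lam y * (ibpOp Q lam)^[M] g y)) := by
  obtain ⟨B, hB0, hB⟩ := exists_isSymbol_ibpOp hQ M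
  obtain ⟨C, hC⟩ := exists_isSymbol_schwartz_smul_sub_one χ hχ M
  have hosc1 := fun y => (norm_osc Q lam y).le
  set P : ℝ := (Real.sqrt 2 * bracket z) ^ (|(1 / 2 : ℝ)| + M) with hP
  set D : ℝ := (B / lam) ^ M * (2 ^ M * (A * (P * C))) * ∫ x : E n, bracket x ^ (-n - 1 / 2 : ℝ)
    with hD
  have key : ∀ ε : ℝ, 0 < ε → ε ≤ 1 →
      ‖(∫ y, osc Q lam y * (g y * χ (ε • (y + z)))) -
        ∫ y, osc Q lam y * (ibpOp Q lam)^[M] g y‖ ≤ D * ε ^ (1 / 2 : ℝ) := by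
    intro ε hε hε1
    -- The error amplitude exceeds the original order by `1/2`; after `M` rounds its order is `-n -
    -- 1/2`, still below `-n`, with a factor `ε ^ (1/2)` in the constant.
    have hd : IsSymbol M (2 * M - n - 1 + 1 / 2) (2 ^ M * (A * (P * (C * ε ^ (1 / 2 : ℝ)))))
        (fun y => g y * (χ (ε • (y + z)) - 1)) :=
      hg.mul ((hC ε hε hε1).comp_add_right z)
    -- For fixed `ε` the Schwartz factor is a symbol of order `-2M`, which makes the product
    -- integrable and legitimizes the integrations by parts.
    have hreg : ∃ c, IsSymbol M (-n - 1) c (fun y => g y * χ (ε • (y + z))) := by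
      obtain ⟨c, hc⟩ := exists_isSymbol_schwartz χ M (-2 * M)
      obtain ⟨c', hc'⟩ := hc.comp_smul hε
      exact ⟨_, (hg.mul (hc'.comp_add_right z)).mono le_rfl (by linarith) le_rfl⟩
    obtain ⟨c, hc⟩ := hreg
    rw [← integral_osc_mul_ibpOp_iterate hQ hQs hlam hc (by linarith)
      (hv.imp_right fun hv y hy => by rw [hv y hy, zero_mul])]
    have hT := isSymbol_ibpOp_iterate (hB lam hlam) le_rfl hd
    have hT1 := isSymbol_ibpOp_iterate (hB lam hlam) le_rfl hc
    have hT2 := isSymbol_ibpOp_iterate (hB lam hlam) le_rfl hg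
    rw [← integral_sub
      (hT1.integrable_mul (by linarith [Nat.cast_nonneg (α := ℝ) M]) (continuous_osc Q lam) hosc1)
      (hT2.integrable_mul (by linarith) (continuous_osc Q lam) hosc1)]
    have e : (fun y => osc Q lam y * (ibpOp Q lam)^[M] (fun y => g y * χ (ε • (y + z))) y -
        osc Q lam y * (ibpOp Q lam)^[M] g y) = fun y => osc Q lam y *
          (ibpOp Q lam)^[M] (fun y => g y * (χ (ε • (y + z)) - 1)) y := by
      have := ibpOp_iterate_sub hQ lam hc.contDiff hg.contDiff
      simp only [mul_sub, mul_one]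
      rw [this]
      funext y
      ring
    rw [e]
    refine (hT.norm_integral_mul_le (by linarith) hosc1).trans (le_of_eq ?_)
    have e2 : (2 * (M : ℝ) - n - 1 + 1 / 2 - 2 * M) = (-n - 1 / 2 : ℝ) := by ring
    rw [e2, hD]
    ring
  rw [tendsto_iff_norm_sub_tendsto_zero]
  have hlim : Tendsto (fun ε : ℝ => D * ε ^ (1 / 2 : ℝ)) (𝓝[>] 0) (𝓝 0) := by
    have : Tendsto (fun ε : ℝ => D * ε ^ (1 / 2 : ℝ)) (𝓝 0) (𝓝 (D * 0 ^ (1 / 2 : ℝ))) :=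
      ((Real.continuous_rpow_const (by norm_num)).tendsto 0).const_mul D
    rw [Real.zero_rpow (by norm_num), mul_zero] at this
    exact this.mono_left nhdsWithin_le_nhds
  refine squeeze_zero' (Eventually.of_forall fun _ => norm_nonneg _) ?_ hlim
  filter_upwards [Ioc_mem_nhdsGT (zero_lt_one (α := ℝ))] with ε hε
  exact key ε hε.1 hε.2

/-- The oscillatory integral of a symbol vanishing near the stationary point is `O(λ^{-M})`. -/
theorem exists_norm_integral_osc_ibpOp_le {n : ℕ} {Q : Matrix (Fin n) (Fin n) ℝ}
    (hQ : Q.det ≠ 0) (M : ℕ) :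
    ∃ B : ℝ, 0 ≤ B ∧ ∀ lam : ℝ, 0 < lam → ∀ (A : ℝ) (g : E n → ℂ),
      IsSymbol M (2 * M - n - 1) A g →
      ‖∫ y, osc Q lam y * (ibpOp Q lam)^[M] g y‖ ≤ B * lam ^ (-(M : ℝ)) * A := by
  obtain ⟨B, hB0, hB⟩ := exists_isSymbol_ibpOp hQ M
  have hI : 0 ≤ ∫ x : E n, bracket x ^ (-n - 1 : ℝ) :=
    integral_nonneg fun x => Real.rpow_nonneg (bracket_pos x).le _
  refine ⟨B ^ M * ∫ x : E n, bracket x ^ (-n - 1 : ℝ), by positivity, fun lam hlam A g hg => ?_⟩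
  have hT := isSymbol_ibpOp_iterate (hB lam hlam) le_rfl hg
  refine (hT.norm_integral_mul_le (by linarith) fun y => (norm_osc Q lam y).le).trans
    (le_of_eq ?_)
  have e2 : (2 * (M : ℝ) - n - 1 - 2 * M) = (-n - 1 : ℝ) := by ring
  rw [e2, Real.rpow_neg hlam.le, Real.rpow_natCast, div_pow]
  ring

/-! ### Fourier transform of complex Gaussians in eigencoordinates -/

/-- The eigenvalues of a symmetric matrix. -/
def eig {n : ℕ} {Q : Matrix (Fin n) (Fin n) ℝ} (hQ : Q.IsSymm) : Fin n → ℝ :=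
  (isHermitian_of_isSymm hQ).eigenvalues

/-- Coordinates with respect to an orthonormal basis of eigenvectors. -/
def coord {n : ℕ} {Q : Matrix (Fin n) (Fin n) ℝ} (hQ : Q.IsSymm) : E n ≃ₗᵢ[ℝ] E n :=
  (isHermitian_of_isSymm hQ).eigenvectorBasis.repr

section Gaussian

variable {n : ℕ} {Q : Matrix (Fin n) (Fin n) ℝ}

/-- The second matrix `A` is there because the identity is needed for `Q`, in the phase, and for
`Q⁻¹`, in the dual phase, in the same eigenbasis. -/
theorem inner_eq_sum_of_eigenvectors (hQ : Q.IsSymm) {A : Matrix (Fin n) (Fin n) ℝ}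
    (hA : A.IsSymm) {r : Fin n → ℝ}
    (h : ∀ j, grad A ((isHermitian_of_isSymm hQ).eigenvectorBasis j) =
      r j • (isHermitian_of_isSymm hQ).eigenvectorBasis j) (y : E n) :
    inner ℝ y (grad A y) = ∑ j, r j * coord hQ y j ^ 2 := by
  rw [← (isHermitian_of_isSymm hQ).eigenvectorBasis.sum_inner_mul_inner]
  refine Finset.sum_congr rfl fun j _ => ?_
  rw [inner_grad_comm hA, h, inner_smul_right, coord, OrthonormalBasis.repr_apply_apply,
    real_inner_comm]
  ring

theorem grad_eigenvectorBasis (hQ : Q.IsSymm) (j : Fin n) :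
    grad Q ((isHermitian_of_isSymm hQ).eigenvectorBasis j) =
      eig hQ j • (isHermitian_of_isSymm hQ).eigenvectorBasis j :=
  WithLp.ofLp_injective 2 ((isHermitian_of_isSymm hQ).mulVec_eigenvectorBasis j)

theorem det_eq_prod_eig (hQ : Q.IsSymm) : Q.det = ∏ j, eig hQ j :=
  (isHermitian_of_isSymm hQ).det_eq_prod_eigenvalues

theorem eig_ne_zero (hQ : Q.IsSymm) (hdet : Q.det ≠ 0) (j : Fin n) : eig hQ j ≠ 0 := by
  rw [det_eq_prod_eig hQ, Finset.prod_ne_zero_iff] at hdet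
  exact hdet j (Finset.mem_univ j)

theorem grad_inv_grad (hdet : Q.det ≠ 0) (y : E n) : grad Q⁻¹ (grad Q y) = y := by
  refine WithLp.ofLp_injective 2 ?_
  change Q⁻¹.mulVec (Q.mulVec y.ofLp) = y.ofLp
  rw [Matrix.mulVec_mulVec, Matrix.nonsing_inv_mul _ (Ne.isUnit hdet), Matrix.one_mulVec]

theorem grad_inv_eigenvectorBasis (hQ : Q.IsSymm) (hdet : Q.det ≠ 0) (j : Fin n) :
    grad Q⁻¹ ((isHermitian_of_isSymm hQ).eigenvectorBasis j) =
      (eig hQ j)⁻¹ • (isHermitian_of_isSymm hQ).eigenvectorBasis j := by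
  have h := grad_inv_grad hdet ((isHermitian_of_isSymm hQ).eigenvectorBasis j)
  rw [grad_eigenvectorBasis hQ, map_smul] at h
  rw [eq_inv_smul_iff₀ (eig_ne_zero hQ hdet j), h]

theorem isSymm_inv (hQ : Q.IsSymm) : (Q⁻¹).IsSymm := by
  rw [Matrix.IsSymm, Matrix.transpose_nonsing_inv, hQ.eq]

theorem norm_sq_eq_sum_coord (hQ : Q.IsSymm) (y : E n) : ‖y‖ ^ 2 = ∑ j, coord hQ y j ^ 2 := by
  rw [← (coord hQ).norm_map y, EuclideanSpace.norm_sq_eq]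
  exact Finset.sum_congr rfl fun j _ => by rw [Real.norm_eq_abs, sq_abs]

/-- The complex coefficients `(ε - iλ q_j) / 2` of the regularized Gaussian. -/
def gaussCoeff (hQ : Q.IsSymm) (lam ε : ℝ) (j : Fin n) : ℂ :=
  (ε - Complex.I * (lam * eig hQ j : ℝ)) / 2

theorem gaussCoeff_re (hQ : Q.IsSymm) (lam ε : ℝ) (j : Fin n) :
    (gaussCoeff hQ lam ε j).re = ε / 2 := by
  simp [gaussCoeff, -Complex.ofReal_mul]

theorem gaussCoeff_im (hQ : Q.IsSymm) (lam ε : ℝ) (j : Fin n) :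
    (gaussCoeff hQ lam ε j).im = -(lam * eig hQ j) / 2 := by
  simp [gaussCoeff, -Complex.ofReal_mul]

theorem exp_gaussCoeff (hQ : Q.IsSymm) (lam ε : ℝ) (y : E n) :
    Complex.exp (-∑ j, gaussCoeff hQ lam ε j * (coord hQ y j : ℂ) ^ 2) =
      osc Q lam y * (Real.exp (-(ε / 2) * ‖y‖ ^ 2) : ℂ) := by
  rw [osc, Complex.ofReal_exp, ← Complex.exp_add, phase_zero_eq,
    inner_eq_sum_of_eigenvectors hQ hQ (grad_eigenvectorBasis hQ), norm_sq_eq_sum_coord hQ]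
  congr 1
  push_cast
  simp only [Finset.mul_sum, Finset.sum_div, gaussCoeff]
  rw [← Finset.sum_neg_distrib, ← Finset.sum_add_distrib]
  refine Finset.sum_congr rfl fun j _ => ?_
  push_cast
  ring

theorem integral_comp_coord (hQ : Q.IsSymm) (F : (Fin n → ℝ) → ℂ) :
    ∫ y : E n, F (fun j => coord hQ y j) = ∫ v, F v := by
  rw [← (PiLp.volume_preserving_ofLp (Fin n)).integral_comp
    (MeasurableEquiv.toLp 2 _).symm.measurableEmbedding F,
    ← (coord hQ).measurePreserving.integral_comp (coord hQ).toHomeomorph.measurableEmbedding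
      fun y : E n => F y.ofLp]

theorem integrable_comp_coord (hQ : Q.IsSymm) {F : (Fin n → ℝ) → ℂ} (hF : Integrable F) :
    Integrable fun y : E n => F (fun j => coord hQ y j) := by
  have h1 := ((PiLp.volume_preserving_ofLp (Fin n)).integrable_comp_emb
    (MeasurableEquiv.toLp 2 _).symm.measurableEmbedding).2 hF
  exact ((coord hQ).measurePreserving.integrable_comp_emb
    (coord hQ).toHomeomorph.measurableEmbedding).2 h1

theorem integrable_exp_gaussCoeff (hQ : Q.IsSymm) (lam : ℝ) {ε : ℝ} (hε : 0 < ε) :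
    Integrable fun y : E n =>
      Complex.exp (-∑ j, gaussCoeff hQ lam ε j * (coord hQ y j : ℂ) ^ 2) := by
  have h := GaussianFourier.integrable_cexp_neg_sum_mul_add (b := gaussCoeff hQ lam ε)
    (fun j => by rw [gaussCoeff_re]; positivity) 0
  simpa using integrable_comp_coord hQ h

/-- In eigencoordinates the integral is a product of one-dimensional Gaussians. The Fourier
character is the linear term with coefficients `-2πi ξ_j`, and completing the square gives `-π² ξ_j²
/ b_j`. -/
theorem fourier_exp_gaussCoeff (hQ : Q.IsSymm) (lam : ℝ) {ε : ℝ} (hε : 0 < ε) (ξ : E n) :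
    𝓕 (fun y : E n =>
      Complex.exp (-∑ j, gaussCoeff hQ lam ε j * (coord hQ y j : ℂ) ^ 2)) ξ =
      (∏ j, ((Real.pi : ℂ) / gaussCoeff hQ lam ε j) ^ (1 / 2 : ℂ)) *
        Complex.exp (-∑ j, (Real.pi : ℂ) ^ 2 * (coord hQ ξ j : ℂ) ^ 2 / gaussCoeff hQ lam ε j) := by
  have h := GaussianFourier.integral_cexp_neg_sum_mul_add (b := gaussCoeff hQ lam ε)
    (fun j => by rw [gaussCoeff_re]; positivity)
    (fun j => -2 * Real.pi * Complex.I * (coord hQ ξ j : ℂ))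
  rw [← integral_comp_coord hQ] at h
  rw [Real.fourier_eq']
  have hin (y : E n) : inner ℝ y ξ = ∑ j, coord hQ y j * coord hQ ξ j := by
    rw [← (coord hQ).inner_map_map, PiLp.inner_apply]
    refine Finset.sum_congr rfl fun j _ => ?_
    simp [mul_comm]
  rw [Finset.prod_mul_distrib, ← Complex.exp_sum] at h
  have e : (∑ j, (-2 * Real.pi * Complex.I * (coord hQ ξ j : ℂ)) ^ 2 /
      (4 * gaussCoeff hQ lam ε j)) =
      -∑ j, (Real.pi : ℂ) ^ 2 * (coord hQ ξ j : ℂ) ^ 2 / gaussCoeff hQ lam ε j := by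
    rw [← Finset.sum_neg_distrib]
    refine Finset.sum_congr rfl fun j _ => ?_
    have hb : gaussCoeff hQ lam ε j ≠ 0 := fun h0 => by
      have := gaussCoeff_re hQ lam ε j
      rw [h0, Complex.zero_re] at this
      linarith
    field_simp
    rw [Complex.I_sq]
    ring
  rw [e] at h
  rw [← h]
  congr 1
  funext y
  rw [smul_eq_mul, ← Complex.exp_add, hin]
  congr 1
  push_cast
  rw [add_comm, Finset.mul_sum, Finset.sum_mul]
  congr 1
  exact Finset.sum_congr rfl fun j _ => by ring

/-- The constant `(2π/λ)^{n/2} e^{iπ sgn Q / 4} |det Q|^{-1/2}`. -/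
def statConst (Q : Matrix (Fin n) (Fin n) ℝ) (hQ : Q.IsSymm) (lam : ℝ) : ℂ :=
  (((2 * Real.pi / lam) ^ ((n : ℝ) / 2) : ℝ) : ℂ) *
    (Complex.exp (Complex.I * (Real.pi / 4) * (sgn Q hQ : ℂ)) /
      ((|Q.det| ^ ((1 : ℝ) / 2) : ℝ) : ℂ))

theorem sgn_eq_sum (hQ : Q.IsSymm) :
    (sgn Q hQ : ℂ) = ∑ j, ((SignType.sign (eig hQ j) : ℝ) : ℂ) := by
  unfold sgn
  rw [Fintype.card_subtype, Fintype.card_subtype, Finset.card_filter, Finset.card_filter]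
  push_cast
  rw [← Finset.sum_sub_distrib]
  refine Finset.sum_congr rfl fun j _ => ?_
  change _ = ((SignType.sign ((isHermitian_of_isSymm hQ).eigenvalues j) : ℝ) : ℂ)
  rcases lt_trichotomy ((isHermitian_of_isSymm hQ).eigenvalues j) 0 with h | h | h
  · simp [h, h.not_gt]
  · simp [h]
  · simp [h, h.not_gt]

/-- At `ε = 0` the base lies on the imaginary axis with argument `±π/2`, the sign being that of the
eigenvalue. The principal square root halves this to `±π/4`; the product over `j` accumulates the
phase `π sgn Q / 4`. -/
theorem cpow_half_pi_div (hQ : Q.IsSymm) (hdet : Q.det ≠ 0) {lam : ℝ} (hlam : 0 < lam)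
    (j : Fin n) : ((Real.pi : ℂ) / gaussCoeff hQ lam 0 j) ^ (1 / 2 : ℂ) =
      (((2 * Real.pi / lam) ^ (1 / 2 : ℝ) / |eig hQ j| ^ (1 / 2 : ℝ) : ℝ) : ℂ) *
        Complex.exp (Complex.I * (Real.pi / 4) * ((SignType.sign (eig hQ j) : ℝ) : ℂ)) := by
  have hq := eig_ne_zero hQ hdet j
  have hq' : 0 < |eig hQ j| := abs_pos.2 hq
  set s : ℝ := (SignType.sign (eig hQ j) : ℝ) with hs
  have hsq : eig hQ j = s * |eig hQ j| := (sign_mul_abs _).symm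
  have hs1 : s = 1 ∨ s = -1 := by
    rcases hq.lt_or_gt with h | h
    · right; simp [hs, h]
    · left; simp [hs, h]
  have hr : 0 < 2 * Real.pi / (lam * |eig hQ j|) := by positivity
  have e : (Real.pi : ℂ) / gaussCoeff hQ lam 0 j =
      ((2 * Real.pi / (lam * |eig hQ j|) : ℝ) : ℂ) *
        Complex.exp (Complex.I * (Real.pi / 2) * (s : ℂ)) := by
    have hexp : Complex.exp (Complex.I * (Real.pi / 2) * (s : ℂ)) = Complex.I * s := by
      rcases hs1 with h | h <;> rw [h]
      · simp [mul_comm Complex.I, Complex.exp_pi_div_two_mul_I]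
      · simp [mul_comm Complex.I, Complex.exp_neg, Complex.exp_pi_div_two_mul_I]
    rw [hexp, gaussCoeff, hsq]
    have h1 : ((|eig hQ j| : ℝ) : ℂ) ≠ 0 := Complex.ofReal_ne_zero.2 hq'.ne'
    have h2 : (lam : ℂ) ≠ 0 := Complex.ofReal_ne_zero.2 hlam.ne'
    have h3 : (s : ℂ) * s = 1 := by rcases hs1 with h | h <;> rw [h] <;> norm_num
    have h4 : (s : ℂ) ≠ 0 := left_ne_zero_of_mul_eq_one h3
    rw [abs_mul, abs_abs]
    have h5 : |s| = 1 := by rcases hs1 with h | h <;> rw [h] <;> norm_num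
    have h6 : Complex.I * ((lam * (s * |eig hQ j|) : ℝ) : ℂ) ≠ 0 := by
      push_cast
      exact mul_ne_zero Complex.I_ne_zero (mul_ne_zero h2 (mul_ne_zero h4 h1))
    rw [h5, one_mul, div_eq_iff (by simpa using h6)]
    have h7 : ((2 * Real.pi / (lam * |eig hQ j|) : ℝ) : ℂ) * (Complex.I * s) *
        ((((0 : ℝ) : ℂ) - Complex.I * ((lam * (s * |eig hQ j|) : ℝ) : ℂ)) / 2) =
        -(Real.pi * Complex.I ^ 2 * (s * s)) := by
      push_cast
      field_simp
      ring
    rw [h7, h3, Complex.I_sq]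
    ring
  have him : (Complex.I * (Real.pi / 2) * (s : ℂ)).im = Real.pi / 2 * s := by
    have : Complex.I * (Real.pi / 2) * (s : ℂ) = ((Real.pi / 2 * s : ℝ) : ℂ) * Complex.I := by
      push_cast
      ring
    rw [this, Complex.im_ofReal_mul, Complex.I_im, mul_one]
  have hpi := Real.pi_pos
  rw [e, Complex.cpow_def_of_ne_zero
      (mul_ne_zero (Complex.ofReal_ne_zero.2 hr.ne') (Complex.exp_ne_zero _)),
    Complex.log_ofReal_mul hr (Complex.exp_ne_zero _),
    Complex.log_exp (by rw [him]; rcases hs1 with h | h <;> rw [h] <;> linarith)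
      (by rw [him]; rcases hs1 with h | h <;> rw [h] <;> linarith),
    ← Real.div_rpow (by positivity) hq'.le, div_div, Real.rpow_def_of_pos hr,
    Complex.ofReal_exp, ← Complex.exp_add]
  congr 1
  push_cast
  ring

theorem prod_cpow_half_pi_div (hQ : Q.IsSymm) (hdet : Q.det ≠ 0) {lam : ℝ} (hlam : 0 < lam) :
    ∏ j, ((Real.pi : ℂ) / gaussCoeff hQ lam 0 j) ^ (1 / 2 : ℂ) = statConst Q hQ lam := by
  simp_rw [cpow_half_pi_div hQ hdet hlam]
  rw [Finset.prod_mul_distrib, ← Complex.exp_sum, ← Finset.mul_sum, ← sgn_eq_sum hQ,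
    ← Complex.ofReal_prod, Finset.prod_div_distrib, Finset.prod_const, Finset.card_univ,
    Fintype.card_fin, Real.finsetProd_rpow _ _ fun j _ => abs_nonneg _, ← Finset.abs_prod,
    ← det_eq_prod_eig, statConst, ← Real.rpow_mul_natCast (by positivity)]
  push_cast
  rw [one_div_mul_eq_div]
  ring

end Gaussian

/-! ### Parseval's identity and the Fresnel limit -/

/-- The multiplication formula applied to `𝓕 f` and `G`: by inversion `𝓕 (𝓕 f)` is the reflection of
`f`, and the evenness of `G` removes the reflection. -/
theorem integral_mul_eq_integral_fourier_mul_fourier {n : ℕ} {f G : E n → ℂ}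
    (hf : Continuous f) (hfi : Integrable f) (hFi : Integrable (𝓕 f)) (hG : Integrable G)
    (hGe : ∀ y, G (-y) = G y) : ∫ y, G y * f y = ∫ ξ, 𝓕 f ξ * 𝓕 G ξ := by
  have h := VectorFourier.integral_fourierIntegral_smul_eq_flip (L := innerₗ (E n))
    (μ := volume) (ν := volume) Real.continuous_fourierChar continuous_inner hFi hG
  have h1 : ∫ y, 𝓕 (𝓕 f) y * G y = ∫ ξ, 𝓕 f ξ * 𝓕 G ξ := by
    simpa [flip_innerₗ] using! h
  rw [← h1, ← integral_neg_eq_self]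
  congr 1
  funext y
  have h2 : 𝓕 (𝓕 f) y = f (-y) := by
    rw [← hf.fourierInv_fourier_eq hfi hFi, Real.fourierInv_eq_fourier_neg, neg_neg,
      hf.fourierInv_fourier_eq hfi hFi]
  rw [h2, hGe, mul_comm]

section Limit

variable {n : ℕ} {Q : Matrix (Fin n) (Fin n) ℝ}

theorem gaussCoeff_ne_zero (hQ : Q.IsSymm) (hdet : Q.det ≠ 0) {lam : ℝ} (hlam : 0 < lam)
    (ε : ℝ) (j : Fin n) : gaussCoeff hQ lam ε j ≠ 0 := fun h => by
  have h1 := gaussCoeff_im hQ lam ε j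
  have h2 := mul_ne_zero hlam.ne' (eig_ne_zero hQ hdet j)
  rw [h, Complex.zero_im] at h1
  exact h2 (by linarith)

theorem continuous_gaussCoeff (hQ : Q.IsSymm) (lam : ℝ) (j : Fin n) :
    Continuous fun ε => gaussCoeff hQ lam ε j := by
  unfold gaussCoeff
  fun_prop

/-- Parseval's identity for a Fresnel integral. -/
theorem integral_osc_mul_eq (hQ : Q.IsSymm) (hdet : Q.det ≠ 0) {lam : ℝ} (hlam : 0 < lam)
    {f : E n → ℂ} (hf : Continuous f) (hfi : Integrable f) (hFi : Integrable (𝓕 f)) :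
    ∫ y, osc Q lam y * f y = statConst Q hQ lam * ∫ ξ, 𝓕 f ξ *
      Complex.exp (-(Complex.I *
        ((2 * Real.pi ^ 2 / lam * inner ℝ ξ (grad Q⁻¹ ξ) : ℝ) : ℂ))) := by
  set G : ℝ → E n → ℂ := fun ε y =>
    Complex.exp (-∑ j, gaussCoeff hQ lam ε j * (coord hQ y j : ℂ) ^ 2) with hG
  set H : ℝ → E n → ℂ := fun ε ξ =>
    Complex.exp (-∑ j, (Real.pi : ℂ) ^ 2 * (coord hQ ξ j : ℂ) ^ 2 / gaussCoeff hQ lam ε j) with hH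
  have hne := gaussCoeff_ne_zero hQ hdet hlam
  have hcont := continuous_gaussCoeff hQ lam
  have hcoord (j : Fin n) : Continuous fun ξ : E n => (coord hQ ξ j : ℂ) :=
    Complex.continuous_ofReal.comp
      ((EuclideanSpace.proj j : E n →L[ℝ] ℝ).continuous.comp (coord hQ).continuous)
  have hGH : ∀ ε : ℝ, 0 < ε → ∫ y, G ε y * f y =
      (∏ j, ((Real.pi : ℂ) / gaussCoeff hQ lam ε j) ^ (1 / 2 : ℂ)) * ∫ ξ, 𝓕 f ξ * H ε ξ := by
    intro ε hε
    rw [integral_mul_eq_integral_fourier_mul_fourier hf hfi hFi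
      (integrable_exp_gaussCoeff hQ lam hε) (fun y => by simp), ← integral_const_mul]
    congr 1
    funext ξ
    rw [fourier_exp_gaussCoeff hQ lam hε]
    ring
  -- Parseval holds for `ε > 0`, where the Gaussian is integrable. Letting `ε → 0+` on both sides is
  -- dominated convergence, with majorants `|f|` here and `|𝓕 f|` on the Fourier side.
  have hL : Tendsto (fun ε => ∫ y, G ε y * f y) (𝓝[>] 0) (𝓝 (∫ y, G 0 y * f y)) := by
    refine tendsto_integral_filter_of_dominated_convergence (fun y => ‖f y‖) ?_ ?_ hfi.norm ?_
    · refine Eventually.of_forall fun ε => (Continuous.mul ?_ hf).aestronglyMeasurable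
      simp only [hG]
      fun_prop
    · filter_upwards [self_mem_nhdsWithin] with ε (hε : 0 < ε)
      refine Eventually.of_forall fun y => ?_
      rw [norm_mul]
      refine mul_le_of_le_one_left (norm_nonneg _) ?_
      simp only [hG, exp_gaussCoeff]
      rw [norm_mul, norm_osc, one_mul, Complex.norm_real, Real.norm_of_nonneg (Real.exp_pos _).le,
        Real.exp_le_one_iff]
      nlinarith [sq_nonneg ‖y‖]
    · refine Eventually.of_forall fun y => Tendsto.mono_left ?_ nhdsWithin_le_nhds
      refine Tendsto.mul_const _ (Continuous.tendsto ?_ 0)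
      simp only [hG]
      fun_prop
  have hR : Tendsto (fun ε => ∫ ξ, 𝓕 f ξ * H ε ξ) (𝓝[>] 0) (𝓝 (∫ ξ, 𝓕 f ξ * H 0 ξ)) := by
    have hHc (ε : ℝ) : Continuous (H ε) := by
      simp only [hH]
      fun_prop
    refine tendsto_integral_filter_of_dominated_convergence (fun y => ‖𝓕 f y‖) ?_ ?_ hFi.norm ?_
    · exact Eventually.of_forall fun ε => hFi.1.mul (hHc ε).aestronglyMeasurable
    · filter_upwards [self_mem_nhdsWithin] with ε (hε : 0 < ε)
      refine Eventually.of_forall fun ξ => ?_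
      rw [norm_mul]
      refine mul_le_of_le_one_right (norm_nonneg _) ?_
      simp only [hH]
      rw [Complex.norm_exp, Real.exp_le_one_iff, Complex.neg_re, Complex.re_sum,
        Left.neg_nonpos_iff]
      refine Finset.sum_nonneg fun j _ => ?_
      have e : (Real.pi : ℂ) ^ 2 * (coord hQ ξ j : ℂ) ^ 2 / gaussCoeff hQ lam ε j =
          ((Real.pi ^ 2 * coord hQ ξ j ^ 2 : ℝ) : ℂ) * (gaussCoeff hQ lam ε j)⁻¹ := by
        push_cast
        ring
      -- `Re(1/b) = Re b / |b|² ≥ 0` bounds the dual Gaussian by `1`.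
      rw [e, Complex.re_ofReal_mul, Complex.inv_re, gaussCoeff_re]
      have := Complex.normSq_nonneg (gaussCoeff hQ lam ε j)
      positivity
    · refine Eventually.of_forall fun ξ => Tendsto.mono_left ?_ nhdsWithin_le_nhds
      refine Tendsto.const_mul _ (Continuous.tendsto ?_ 0)
      simp only [hH]
      refine Complex.continuous_exp.comp (continuous_finsetSum _ fun j _ => ?_).neg
      exact continuous_const.div (hcont j) (fun ε => hne ε j)
  have hP : Tendsto (fun ε => ∏ j, ((Real.pi : ℂ) / gaussCoeff hQ lam ε j) ^ (1 / 2 : ℂ))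
      (𝓝[>] 0) (𝓝 (statConst Q hQ lam)) := by
    rw [← prod_cpow_half_pi_div hQ hdet hlam]
    refine Tendsto.mono_left (tendsto_finsetProd _ fun j _ => ?_) nhdsWithin_le_nhds
    have hdiv : Continuous fun ε => (Real.pi : ℂ) / gaussCoeff hQ lam ε j :=
      continuous_const.div (hcont j) fun ε => hne ε j
    -- The limit base is a nonzero imaginary number, hence off the branch cut of the square root.
    refine (continuousAt_cpow_const ?_).tendsto.comp (hdiv.tendsto 0)
    rw [Complex.mem_slitPlane_iff]
    right
    have e : (Real.pi : ℂ) / gaussCoeff hQ lam 0 j =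
        (Real.pi : ℝ) * (gaussCoeff hQ lam 0 j)⁻¹ := div_eq_mul_inv _ _
    rw [e, Complex.im_ofReal_mul, Complex.inv_im, gaussCoeff_im]
    have h1 := Complex.normSq_pos.2 (hne 0 j)
    have h2 := mul_ne_zero hlam.ne' (eig_ne_zero hQ hdet j)
    have h3 : -(-(lam * eig hQ j) / 2) ≠ 0 := fun h => h2 (by linarith)
    exact mul_ne_zero Real.pi_ne_zero (div_ne_zero h3 h1.ne')
  have hlim := tendsto_nhds_unique (hL.congr' (by
    filter_upwards [self_mem_nhdsWithin] with ε hε using hGH ε hε)) (hP.mul hR)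
  have e1 : ∫ y, osc Q lam y * f y = ∫ y, G 0 y * f y := by
    congr 1
    funext y
    simp only [hG, exp_gaussCoeff]
    simp
  rw [e1, hlim]
  congr 2
  funext ξ
  simp only [hH]
  congr 3
  rw [inner_eq_sum_of_eigenvectors hQ (isSymm_inv hQ) (grad_inv_eigenvectorBasis hQ hdet)]
  push_cast
  rw [Finset.mul_sum, Finset.mul_sum]
  refine Finset.sum_congr rfl fun j _ => ?_
  have h1 : (eig hQ j : ℂ) ≠ 0 := Complex.ofReal_ne_zero.2 (eig_ne_zero hQ hdet j)
  have h2 : (lam : ℂ) ≠ 0 := Complex.ofReal_ne_zero.2 hlam.ne'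
  rw [div_eq_iff (hne 0 j), gaussCoeff]
  push_cast
  field_simp
  ring_nf
  rw [Complex.I_sq]
  ring

end Limit

/-! ### Taylor remainder and Fourier multipliers -/

/-- For `|t| ≤ 1` this is the Taylor estimate, with factor `e`. For `|t| ≥ 1` the exponential is
unimodular and each of the `N + 1` terms is at most `|t| ^ (N + 1)`, which accounts for the summand
`N + 2`. -/
theorem exists_norm_exp_sub_sum_le (N : ℕ) :
    ∃ C : ℝ, 0 ≤ C ∧ ∀ t : ℝ,
      ‖Complex.exp (-(Complex.I * (t : ℂ))) -
        ∑ j ∈ Finset.range (N + 1), (-(Complex.I * (t : ℂ))) ^ j / (j.factorial : ℂ)‖ ≤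
        C * |t| ^ (N + 1) := by
  refine ⟨Real.exp 1 + (N + 2), by positivity, fun t => ?_⟩
  set z : ℂ := -(Complex.I * (t : ℂ)) with hz
  have hzn : ‖z‖ = |t| := by simp [hz]
  have ht := abs_nonneg t
  rcases le_total |t| 1 with h | h
  · have h1 := Complex.norm_exp_sub_sum_le_norm_mul_exp z (N + 1)
    rw [hzn] at h1
    refine h1.trans ?_
    rw [mul_comm]
    have : Real.exp |t| ≤ Real.exp 1 := Real.exp_le_exp.2 h
    gcongr
    linarith [Nat.cast_nonneg (α := ℝ) N]
  · have h0 : ‖Complex.exp z‖ = 1 := by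
      have : z = ((-t : ℝ) : ℂ) * Complex.I := by
        rw [hz]
        push_cast
        ring
      rw [this, Complex.norm_exp_ofReal_mul_I]
    have h2 : ‖∑ j ∈ Finset.range (N + 1), z ^ j / (j.factorial : ℂ)‖ ≤
        (N + 1) * |t| ^ (N + 1) := by
      refine (norm_sum_le _ _).trans ?_
      have : ∀ j ∈ Finset.range (N + 1), ‖z ^ j / (j.factorial : ℂ)‖ ≤ |t| ^ (N + 1) := by
        intro j hj
        rw [norm_div, norm_pow, hzn, Complex.norm_natCast]
        refine (div_le_self (by positivity) (by exact_mod_cast j.factorial_pos)).trans ?_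
        exact pow_le_pow_right₀ h (Finset.mem_range.1 hj).le
      simpa using Finset.sum_le_card_nsmul _ _ _ this
    have h3 : 1 ≤ |t| ^ (N + 1) := one_le_pow₀ h
    have h4 := norm_sub_le (Complex.exp z) (∑ j ∈ Finset.range (N + 1), z ^ j / (j.factorial : ℂ))
    nlinarith [Real.exp_pos 1]

section FourierQuad

variable {n : ℕ}

theorem hasCompactSupport_pderiv {f : E n → ℂ} (j : Fin n) (hf : HasCompactSupport f) :
    HasCompactSupport (pderiv j f) :=
  hf.fderiv_apply (𝕜 := ℝ) _

theorem hasCompactSupport_quadOp {f : E n → ℂ} (A : Matrix (Fin n) (Fin n) ℝ)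
    (hf : HasCompactSupport f) : HasCompactSupport (quadOp A f) := by
  refine hf.mono' ?_
  intro x hx
  by_contra h
  refine hx ?_
  have h1 : ∀ j k : Fin n, Dop k (Dop j f) x = 0 := by
    intro j k
    have e : f =ᶠ[𝓝 x] 0 := notMem_tsupport_iff_eventuallyEq.1 h
    have e1 : Dop j f =ᶠ[𝓝 x] fun _ => 0 := by
      filter_upwards [e.eventuallyEq_nhds] with y hy
      unfold Dop pderiv
      rw [hy.fderiv_eq]
      simp
    unfold Dop at e1 ⊢
    unfold pderiv at e1 ⊢
    rw [e1.fderiv_eq]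
    simp
  unfold quadOp
  simp [h1]

theorem contDiff_Dop {k : ℕ} {f : E n → ℂ} (j : Fin n)
    (hf : ContDiff ℝ ((k + 1 : ℕ) : WithTop ℕ∞) f) : ContDiff ℝ (k : WithTop ℕ∞) (Dop j f) :=
  contDiff_const.mul (contDiff_pderiv j hf)

theorem contDiff_quadOp {k : ℕ} {f : E n → ℂ} (A : Matrix (Fin n) (Fin n) ℝ)
    (hf : ContDiff ℝ ((k + 2 : ℕ) : WithTop ℕ∞) f) :
    ContDiff ℝ (k : WithTop ℕ∞) (quadOp A f) :=
  (ContDiff.sum fun _ _ => ContDiff.sum fun l _ =>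
    contDiff_const.mul (contDiff_Dop l (contDiff_Dop _ hf))).div_const _

theorem fourier_Dop {f : E n → ℂ} (hf : ContDiff ℝ 1 f) (hs : HasCompactSupport f) (j : Fin n)
    (ξ : E n) : 𝓕 (Dop j f) ξ = (2 * Real.pi * ξ j : ℝ) * 𝓕 f ξ := by
  have hfi : Integrable f := hf.continuous.integrable_of_hasCompactSupport hs
  have hdi : Integrable (fderiv ℝ f) :=
    (hf.continuous_fderiv one_ne_zero).integrable_of_hasCompactSupport (hs.fderiv (𝕜 := ℝ))
  have h1 : 𝓕 (pderiv j f) ξ = 2 * Real.pi * Complex.I * ξ j * 𝓕 f ξ := by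
    have h := Real.fourier_continuousLinearMap_apply (v := ξ)
      (a := EuclideanSpace.single j (1 : ℝ)) hdi
    rw [Real.fourier_fderiv hfi (hf.differentiable one_ne_zero) hdi] at h
    have h2 : innerSL ℝ ξ (EuclideanSpace.single j (1 : ℝ)) = ξ j := by
      rw [innerSL_apply_apply]
      simp [EuclideanSpace.inner_single_right]
    change 𝓕 (fun x => fderiv ℝ f x (EuclideanSpace.single j 1)) ξ = _
    rw [← h]
    simp [VectorFourier.fourierSMulRight_apply, h2]
    ring
  have h2 : 𝓕 (Dop j f) ξ = (1 / Complex.I) * 𝓕 (pderiv j f) ξ := by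
    rw [Real.fourier_eq', Real.fourier_eq', ← integral_const_mul]
    congr 1
    funext y
    simp only [Dop, smul_eq_mul]
    ring
  rw [h2, h1]
  push_cast
  field_simp

theorem fourier_quadOp {f : E n → ℂ} (hf : ContDiff ℝ 2 f) (hs : HasCompactSupport f)
    (A : Matrix (Fin n) (Fin n) ℝ) (ξ : E n) :
    𝓕 (quadOp A f) ξ =
      -(Complex.I * (2 * Real.pi ^ 2 * inner ℝ ξ (grad A ξ) : ℝ)) * 𝓕 f ξ := by
  have hD1 (j : Fin n) : ContDiff ℝ 1 (Dop j f) := contDiff_Dop (k := 1) j hf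
  have hDs (j : Fin n) : HasCompactSupport (Dop j f) := (hasCompactSupport_pderiv j hs).mul_left
  have hDD (j k : Fin n) : Continuous (Dop k (Dop j f)) :=
    (contDiff_Dop (k := 0) k (hD1 j)).continuous
  have hint (j k : Fin n) : Integrable fun y : E n =>
      Complex.exp (↑(-2 * Real.pi * inner ℝ y ξ) * Complex.I) * Dop k (Dop j f) y := by
    refine Continuous.integrable_of_hasCompactSupport ?_
      (hasCompactSupport_pderiv k (hDs j)).mul_left.mul_left
    exact Continuous.mul (by fun_prop) (hDD j k)
  have h1 : 𝓕 (quadOp A f) ξ =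
      (∑ j, ∑ k, (A j k : ℂ) * 𝓕 (Dop k (Dop j f)) ξ) / (2 * Complex.I) := by
    simp only [Real.fourier_eq', smul_eq_mul, ← integral_const_mul]
    rw [Finset.sum_congr rfl fun j _ =>
      (integral_finsetSum Finset.univ fun k _ => (hint j k).const_mul (A j k : ℂ)).symm,
      ← integral_finsetSum Finset.univ fun j _ =>
        integrable_finsetSum Finset.univ fun k _ => (hint j k).const_mul (A j k : ℂ),
      ← integral_div]
    congr 1
    funext y
    simp only [quadOp, ← mul_div_assoc, Finset.mul_sum]
    congr 1
    refine Finset.sum_congr rfl fun j _ => Finset.sum_congr rfl fun k _ => ?_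
    ring
  have h2 : inner ℝ ξ (grad A ξ) = ∑ j, ∑ k, A j k * ξ k * ξ j := by
    rw [grad, Matrix.inner_toEuclideanCLM]
    simp only [dotProduct, Matrix.mulVec, Finset.mul_sum]
    refine Finset.sum_congr rfl fun j _ => Finset.sum_congr rfl fun k _ => ?_
    ring
  rw [h1, h2, div_eq_iff (by simp)]
  push_cast
  simp only [Finset.mul_sum, Finset.sum_mul, ← Finset.sum_neg_distrib]
  refine Finset.sum_congr rfl fun j _ => Finset.sum_congr rfl fun k _ => ?_
  rw [fourier_Dop (hD1 j) (hDs j), fourier_Dop (hf.of_le (by norm_num)) hs]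
  push_cast
  ring_nf
  rw [Complex.I_sq]
  ring

/-- Each application costs two derivatives, keeps the support compact and multiplies the Fourier
transform by `-2π²i⟨Aξ, ξ⟩`, the coefficient that occurs in the dual phase. -/
theorem quadOp_iterate_properties {A : Matrix (Fin n) (Fin n) ℝ} (j : ℕ) :
    ∀ (k : ℕ) {f : E n → ℂ}, ContDiff ℝ ((k + 2 * j : ℕ) : WithTop ℕ∞) f → HasCompactSupport f →
      ContDiff ℝ (k : WithTop ℕ∞) ((quadOp A)^[j] f) ∧ HasCompactSupport ((quadOp A)^[j] f) ∧
      ∀ ξ, 𝓕 ((quadOp A)^[j] f) ξ =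
        (-(Complex.I * (2 * Real.pi ^ 2 * inner ℝ ξ (grad A ξ) : ℝ))) ^ j * 𝓕 f ξ := by
  induction j with
  | zero => intro k f hf hs; exact ⟨hf, hs, fun ξ => by simp⟩
  | succ j ih =>
    intro k f hf hs
    obtain ⟨h1, h2, h3⟩ := ih k (contDiff_quadOp A hf) (hasCompactSupport_quadOp A hs)
    simp only [Function.iterate_succ_apply]
    refine ⟨h1, h2, fun ξ => ?_⟩
    rw [h3, fourier_quadOp (hf.of_le (by norm_cast; omega)) hs]
    ring

/-- Decay of the Fourier transform of a function supported in the unit ball. -/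
theorem exists_norm_fourier_le (n K : ℕ) :
    ∃ C : ℝ, 0 ≤ C ∧ ∀ (f : E n → ℂ) (S : ℝ), ContDiff ℝ (K : WithTop ℕ∞) f →
      tsupport f ⊆ Metric.closedBall 0 1 → (∀ p ≤ K, ∀ y, ‖iteratedFDeriv ℝ p f y‖ ≤ S) →
      ∀ ξ, ‖𝓕 f ξ‖ ≤ C * S * bracket ξ ^ (-(K : ℝ)) := by
  set V : ℝ := volume.real (Metric.closedBall (0 : E n) 1) with hV
  have hV0 : 0 ≤ V := measureReal_nonneg
  refine ⟨2 * 2 ^ K * (2 ^ K * ((K + 1) * V)), by positivity, fun f S hf hts hS ξ => ?_⟩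
  have hcs : HasCompactSupport f := HasCompactSupport.of_support_subset_isCompact
    (isCompact_closedBall 0 1) ((subset_tsupport f).trans hts)
  have hS0 : 0 ≤ S := (norm_nonneg _).trans (hS 0 (Nat.zero_le _) 0)
  have hc (p : ℕ) (hp : p ≤ K) : Continuous (iteratedFDeriv ℝ p f) :=
    hf.continuous_iteratedFDeriv (by exact_mod_cast hp)
  have hint : ∀ k p : ℕ, (k : ℕ∞) ≤ 0 → (p : ℕ∞) ≤ K →
      Integrable fun v => ‖v‖ ^ k * ‖iteratedFDeriv ℝ p f v‖ := by
    intro k p hk hp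
    have hp' : p ≤ K := by exact_mod_cast hp
    refine Continuous.integrable_of_hasCompactSupport ?_ (hcs.iteratedFDeriv p).norm.mul_left
    exact (continuous_norm.pow k).mul (hc p hp').norm
  have hbd (p : ℕ) (hp : p ≤ K) : ∫ v, ‖iteratedFDeriv ℝ p f v‖ ≤ S * V := by
    have h0 : ∀ v ∉ Metric.closedBall (0 : E n) 1, ‖iteratedFDeriv ℝ p f v‖ = 0 := by
      intro v hv
      rw [norm_eq_zero]
      by_contra h
      exact hv (hts (support_iteratedFDeriv_subset (𝕜 := ℝ) (n := p) h))
    rw [← setIntegral_eq_integral_of_forall_compl_eq_zero h0]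
    have h1 := norm_setIntegral_le_of_norm_le_const (μ := volume) (C := S)
      (f := fun v => ‖iteratedFDeriv ℝ p f v‖) (s := Metric.closedBall (0 : E n) 1)
      (isCompact_closedBall _ _).measure_lt_top (fun v _ => by
        rw [norm_norm]; exact hS p hp v)
    exact (le_abs_self _).trans h1
  -- Every derivative of `f` buys one power of `|ξ|`; the `L¹` norms are bounded by the supremum
  -- times the volume of the unit ball. Only `p = 0` and `p = K` are used afterwards.
  have key : ∀ p ≤ K, ‖ξ‖ ^ p * ‖𝓕 f ξ‖ ≤ 2 ^ K * ((K + 1) * V) * S := by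
    intro p hp
    have h := Real.pow_mul_norm_iteratedFDeriv_fourier_le (K := 0) (N := K) (by exact_mod_cast hf)
      hint (k := 0) (n := p) le_rfl (by exact_mod_cast hp) ξ
    rw [norm_iteratedFDeriv_zero] at h
    refine h.trans ?_
    have h1 : (∑ q ∈ Finset.range (0 + 1) ×ˢ Finset.range (p + 1),
        ∫ v, ‖v‖ ^ q.1 * ‖iteratedFDeriv ℝ q.2 f v‖) ≤ (K + 1) * (S * V) := by
      have h2 : ∀ q ∈ Finset.range (0 + 1) ×ˢ Finset.range (p + 1),
          ∫ v, ‖v‖ ^ q.1 * ‖iteratedFDeriv ℝ q.2 f v‖ ≤ S * V := by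
        intro q hq
        simp only [Finset.mem_product, Finset.mem_range] at hq
        have : q.1 = 0 := by omega
        simp only [this, pow_zero, one_mul]
        exact hbd q.2 (by omega)
      refine (Finset.sum_le_card_nsmul _ _ _ h2).trans ?_
      rw [Finset.card_product, Finset.card_range, Finset.card_range, nsmul_eq_mul]
      have : (p : ℝ) ≤ K := by exact_mod_cast hp
      push_cast
      rw [one_mul]
      gcongr
    have h3 : (2 * Real.pi) ^ 0 * (2 * ((0 : ℕ) : ℝ) + 2) ^ p ≤ 2 ^ K := by
      simp only [pow_zero, Nat.cast_zero, mul_zero, zero_add, one_mul]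
      exact pow_le_pow_right₀ one_le_two hp
    calc _ ≤ 2 ^ K * ((K + 1) * (S * V)) := by gcongr
      _ = _ := by ring
  have hb := bracket_pos ξ
  rw [Real.rpow_neg hb.le, Real.rpow_natCast, ← div_eq_mul_inv, le_div_iff₀ (by positivity)]
  have h1 : bracket ξ ^ K ≤ 2 ^ K * (1 + ‖ξ‖ ^ K) := by
    have h2 : bracket ξ ≤ 2 * max 1 ‖ξ‖ := (bracket_le_one_add_norm ξ).trans (by
      linarith [le_max_left 1 ‖ξ‖, le_max_right 1 ‖ξ‖])
    refine (pow_le_pow_left₀ hb.le h2 K).trans ?_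
    rw [mul_pow]
    gcongr
    rcases le_total 1 ‖ξ‖ with h | h
    · rw [max_eq_right h]
      linarith
    · rw [max_eq_left h, one_pow]
      linarith [pow_nonneg (norm_nonneg ξ) K]
  have h0 := key 0 (Nat.zero_le _)
  have hK := key K le_rfl
  rw [pow_zero, one_mul] at h0
  calc ‖𝓕 f ξ‖ * bracket ξ ^ K ≤ ‖𝓕 f ξ‖ * (2 ^ K * (1 + ‖ξ‖ ^ K)) := by gcongr
    _ = 2 ^ K * (‖𝓕 f ξ‖ + ‖ξ‖ ^ K * ‖𝓕 f ξ‖) := by ring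
    _ ≤ 2 ^ K * (2 ^ K * ((K + 1) * V) * S + 2 ^ K * ((K + 1) * V) * S) := by gcongr
    _ = _ := by ring

end FourierQuad

/-! ### Stationary phase for amplitudes supported in the unit ball -/

theorem norm_statConst {n : ℕ} (Q : Matrix (Fin n) (Fin n) ℝ) (hQ : Q.IsSymm) {lam : ℝ}
    (hlam : 0 < lam) : ‖statConst Q hQ lam‖ =
      (2 * Real.pi) ^ ((n : ℝ) / 2) / |Q.det| ^ ((1 : ℝ) / 2) * lam ^ (-((n : ℝ) / 2)) := by
  have hpi := Real.pi_pos
  have e : Complex.I * (Real.pi / 4) * (sgn Q hQ : ℂ) =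
      ((Real.pi / 4 * sgn Q hQ : ℝ) : ℂ) * Complex.I := by
    push_cast
    ring
  rw [statConst, norm_mul, norm_div, e, Complex.norm_exp_ofReal_mul_I, Complex.norm_real,
    Complex.norm_real, Real.norm_of_nonneg (by positivity), Real.norm_of_nonneg (by positivity),
    Real.div_rpow (by positivity) hlam.le, Real.rpow_neg hlam.le]
  ring

theorem abs_inner_grad_le {n : ℕ} (A : Matrix (Fin n) (Fin n) ℝ) (ξ : E n) :
    |inner ℝ ξ (grad A ξ)| ≤ ‖grad A‖ * bracket ξ ^ (2 : ℝ) := by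
  have h1 := abs_real_inner_le_norm ξ (grad A ξ)
  have h2 := (grad A).le_opNorm ξ
  have h3 : ‖ξ‖ ^ 2 ≤ bracket ξ ^ (2 : ℝ) := by
    rw [Real.rpow_two, bracket_sq]
    linarith
  calc _ ≤ ‖ξ‖ * (‖grad A‖ * ‖ξ‖) := h1.trans (by gcongr)
    _ = ‖grad A‖ * ‖ξ‖ ^ 2 := by ring
    _ ≤ _ := by gcongr

theorem continuous_fourier {n : ℕ} {f : E n → ℂ} (hf : Integrable f) : Continuous (𝓕 f) :=
  VectorFourier.fourierIntegral_continuous (L := innerₗ (E n)) Real.continuous_fourierChar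
    continuous_inner hf

/-- Stationary phase for amplitudes of class `C^{n+2N+3}` supported in the unit ball. -/
theorem exists_stationary_phase {n : ℕ} {Q : Matrix (Fin n) (Fin n) ℝ} (hQ : Q.IsSymm)
    (hdet : Q.det ≠ 0) (N : ℕ) :
    ∃ C : ℝ, 0 ≤ C ∧ ∀ (f : E n → ℂ) (S : ℝ),
      ContDiff ℝ ((n + 2 * N + 3 : ℕ) : WithTop ℕ∞) f → tsupport f ⊆ Metric.closedBall 0 1 →
      (∀ p ≤ n + 2 * N + 3, ∀ y, ‖iteratedFDeriv ℝ p f y‖ ≤ S) → ∀ lam : ℝ, 0 < lam →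
      ‖(∫ y, osc Q lam y * f y) - statConst Q hQ lam * ∑ j ∈ Finset.range (N + 1),
          (((lam : ℂ) ^ j)⁻¹ / (Nat.factorial j : ℂ)) * ((quadOp Q⁻¹)^[j] f) 0‖ ≤
        C * lam ^ (-((n : ℝ) / 2) - (N : ℝ) - 1) * S := by
  -- The Taylor remainder costs `⟨ξ⟩^{2N+2}`; decay of order `K` leaves `⟨ξ⟩^{-n-1}`, the integrable
  -- weight `J`.
  set K := n + 2 * N + 3 with hK
  obtain ⟨A, hA0, hA⟩ := exists_norm_fourier_le n K
  obtain ⟨B, hB0, hB⟩ := exists_norm_exp_sub_sum_le N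
  have hpi := Real.pi_pos
  set c₀ : ℝ := (2 * Real.pi) ^ ((n : ℝ) / 2) / |Q.det| ^ ((1 : ℝ) / 2) with hc₀
  set G : ℝ := ‖grad Q⁻¹‖ with hG
  set J : ℝ := ∫ x : E n, bracket x ^ (-n - 1 : ℝ) with hJ
  have hJ0 : 0 ≤ J := integral_nonneg fun x => Real.rpow_nonneg (bracket_pos x).le _
  refine ⟨c₀ * (B * (2 * Real.pi ^ 2 * G) ^ (N + 1) * A * J), by positivity,
    fun f S hf hts hS lam hlam => ?_⟩
  have hcs : HasCompactSupport f := HasCompactSupport.of_support_subset_isCompact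
    (isCompact_closedBall 0 1) ((subset_tsupport f).trans hts)
  have hfi : Integrable f := hf.continuous.integrable_of_hasCompactSupport hcs
  have hFc : Continuous (𝓕 f) := continuous_fourier hfi
  have hF := hA f S hf hts hS
  have hS0 : 0 ≤ S := (norm_nonneg _).trans (hS 0 (Nat.zero_le _) 0)
  have hKr : (K : ℝ) = n + 2 * N + 3 := by rw [hK]; push_cast; ring
  set q : E n → ℝ := fun ξ => inner ℝ ξ (grad Q⁻¹ ξ) with hq
  have hqc : Continuous q := by
    simp only [hq]
    fun_prop
  have hqle (ξ : E n) : |q ξ| ≤ G * bracket ξ ^ (2 : ℝ) := abs_inner_grad_le _ _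
  have hbpow (ξ : E n) (j : ℕ) : (bracket ξ ^ (2 : ℝ)) ^ j = bracket ξ ^ (2 * j : ℝ) := by
    rw [← Real.rpow_natCast, ← Real.rpow_mul (bracket_pos ξ).le]
  -- The free scale `s` covers three uses: `s = 0` for `𝓕 f` itself, `s = 2π²` for the inversion
  -- formula, and `s = 2π²/λ` for the Taylor terms.
  have hint (s : ℝ) (j : ℕ) (hj : j ≤ N) :
      Integrable fun ξ => (-(Complex.I * ((s * q ξ : ℝ) : ℂ))) ^ j * 𝓕 f ξ := by
    have hj' : (j : ℝ) ≤ N := by exact_mod_cast hj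
    refine ((integrable_bracket_rpow (n := n) (m := 2 * j - K) (by linarith)).const_mul
      ((|s| * G) ^ j * (A * S))).mono' ?_ (Eventually.of_forall fun ξ => ?_)
    · exact Continuous.aestronglyMeasurable (by fun_prop)
    have hb := bracket_pos ξ
    rw [norm_mul, norm_pow, norm_neg, norm_mul, Complex.norm_I, one_mul, Complex.norm_real,
      Real.norm_eq_abs, abs_mul]
    have h1 : |s| * |q ξ| ≤ |s| * (G * bracket ξ ^ (2 : ℝ)) := by
      gcongr
      exact hqle ξ
    calc (|s| * |q ξ|) ^ j * ‖𝓕 f ξ‖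
        ≤ (|s| * (G * bracket ξ ^ (2 : ℝ))) ^ j * (A * S * bracket ξ ^ (-(K : ℝ))) := by
          gcongr
          exact hF ξ
      _ = (|s| * G) ^ j * (A * S) * ((bracket ξ ^ (2 : ℝ)) ^ j * bracket ξ ^ (-(K : ℝ))) := by
          ring
      _ = _ := by
          rw [hbpow, ← Real.rpow_add hb]
          congr 2
  have hFi : Integrable (𝓕 f) := by simpa using hint 0 0 (Nat.zero_le _)
  -- Fourier inversion evaluated at the origin.
  have hquad (j : ℕ) (hj : j ≤ N) : ((quadOp Q⁻¹)^[j] f) 0 =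
      ∫ ξ, (-(Complex.I * ((2 * Real.pi ^ 2 * q ξ : ℝ) : ℂ))) ^ j * 𝓕 f ξ := by
    obtain ⟨h1, h2, h3⟩ := quadOp_iterate_properties (A := Q⁻¹) j 0 (f := f)
      (hf.of_le (by exact_mod_cast (by omega))) hcs
    have h4 : 𝓕 ((quadOp Q⁻¹)^[j] f) =
        fun ξ => (-(Complex.I * ((2 * Real.pi ^ 2 * q ξ : ℝ) : ℂ))) ^ j * 𝓕 f ξ := funext h3
    have h5 := congrFun (h1.continuous.fourierInv_fourier_eq
      (h1.continuous.integrable_of_hasCompactSupport h2)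
      (by rw [h4]; exact hint (2 * Real.pi ^ 2) j hj)) 0
    rw [← h5, Real.fourierInv_eq', h4]
    simp
  set τ : E n → ℝ := fun ξ => 2 * Real.pi ^ 2 / lam * q ξ with hτ
  have hterm (j : ℕ) (hj : j ∈ Finset.range (N + 1)) :
      (((lam : ℂ) ^ j)⁻¹ / (Nat.factorial j : ℂ)) * ((quadOp Q⁻¹)^[j] f) 0 =
        ∫ ξ, (-(Complex.I * (τ ξ : ℂ))) ^ j * 𝓕 f ξ / (Nat.factorial j : ℂ) := by
    rw [hquad j (Nat.lt_succ_iff.1 (Finset.mem_range.1 hj)), ← integral_const_mul]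
    congr 1
    funext ξ
    have e : -(Complex.I * (τ ξ : ℂ)) =
        (lam : ℂ)⁻¹ * -(Complex.I * ((2 * Real.pi ^ 2 * q ξ : ℝ) : ℂ)) := by
      simp only [hτ]
      push_cast
      ring
    rw [e, mul_pow, inv_pow]
    ring
  have htint (j : ℕ) (hj : j ∈ Finset.range (N + 1)) :
      Integrable fun ξ => (-(Complex.I * (τ ξ : ℂ))) ^ j * 𝓕 f ξ / (Nat.factorial j : ℂ) :=
    (hint _ j (Nat.lt_succ_iff.1 (Finset.mem_range.1 hj))).div_const _
  have hmain : Integrable fun ξ => 𝓕 f ξ * Complex.exp (-(Complex.I * (τ ξ : ℂ))) := by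
    refine hFi.norm.mono' (Continuous.aestronglyMeasurable (by fun_prop))
      (Eventually.of_forall fun ξ => ?_)
    have e : -(Complex.I * (τ ξ : ℂ)) = ((-τ ξ : ℝ) : ℂ) * Complex.I := by
      push_cast
      ring
    rw [norm_mul, e, Complex.norm_exp_ofReal_mul_I, mul_one]
  rw [integral_osc_mul_eq hQ hdet hlam hf.continuous hfi hFi, ← mul_sub,
    Finset.sum_congr rfl hterm, ← integral_finsetSum _ htint,
    ← integral_sub hmain (integrable_finsetSum _ htint), norm_mul, norm_statConst Q hQ hlam]
  have hbound : ‖∫ ξ, (𝓕 f ξ * Complex.exp (-(Complex.I * (τ ξ : ℂ))) -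
      ∑ j ∈ Finset.range (N + 1),
        (-(Complex.I * (τ ξ : ℂ))) ^ j * 𝓕 f ξ / (Nat.factorial j : ℂ))‖ ≤
      (B * (2 * Real.pi ^ 2 * G) ^ (N + 1) * A) * (lam⁻¹ ^ (N + 1) * S) * J := by
    rw [hJ, ← integral_const_mul]
    refine norm_integral_le_of_norm_le
      ((integrable_bracket_rpow (n := n) (m := -n - 1) (by linarith)).const_mul _)
      (Eventually.of_forall fun ξ => ?_)
    have hb := bracket_pos ξ
    have e : 𝓕 f ξ * Complex.exp (-(Complex.I * (τ ξ : ℂ))) - ∑ j ∈ Finset.range (N + 1),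
        (-(Complex.I * (τ ξ : ℂ))) ^ j * 𝓕 f ξ / (Nat.factorial j : ℂ) =
        𝓕 f ξ * (Complex.exp (-(Complex.I * (τ ξ : ℂ))) - ∑ j ∈ Finset.range (N + 1),
          (-(Complex.I * (τ ξ : ℂ))) ^ j / (Nat.factorial j : ℂ)) := by
      rw [mul_sub, Finset.mul_sum]
      congr 1
      exact Finset.sum_congr rfl fun j _ => by ring
    have hτle : |τ ξ| ≤ 2 * Real.pi ^ 2 * lam⁻¹ * (G * bracket ξ ^ (2 : ℝ)) := by
      simp only [hτ]
      rw [abs_mul, abs_of_pos (by positivity), div_eq_mul_inv]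
      gcongr
      exact hqle ξ
    have hbK : bracket ξ ^ (-n - 1 : ℝ) =
        bracket ξ ^ (-(K : ℝ)) * (bracket ξ ^ (2 : ℝ)) ^ (N + 1) := by
      rw [hbpow, ← Real.rpow_add hb, hKr]
      congr 1
      push_cast
      ring
    rw [e, norm_mul, hbK]
    calc _ ≤ (A * S * bracket ξ ^ (-(K : ℝ))) *
          (B * (2 * Real.pi ^ 2 * lam⁻¹ * (G * bracket ξ ^ (2 : ℝ))) ^ (N + 1)) := by
          gcongr
          · exact hF ξ
          · exact (hB _).trans (by gcongr)
      _ = _ := by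
          rw [mul_pow, mul_pow, mul_pow, mul_pow]
          ring
  have hlamp : lam ^ (-((n : ℝ) / 2) - (N : ℝ) - 1) =
      lam ^ (-((n : ℝ) / 2)) * lam⁻¹ ^ (N + 1) := by
    rw [inv_pow, ← Real.rpow_natCast, ← Real.rpow_neg hlam.le, ← Real.rpow_add hlam]
    congr 1
    push_cast
    ring
  rw [hlamp]
  calc _ ≤ c₀ * lam ^ (-((n : ℝ) / 2)) *
        ((B * (2 * Real.pi ^ 2 * G) ^ (N + 1) * A) * (lam⁻¹ ^ (N + 1) * S) * J) := by
        gcongr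
    _ = _ := by ring

/-! ### Cutoff, uniqueness of the limit, locality of the expansion -/

theorem IsSymbol.sub {n k : ℕ} {m C C' : ℝ} {f g : E n → ℂ} (hf : IsSymbol k m C f)
    (hg : IsSymbol k m C' g) : IsSymbol k m (C + C') (fun x => f x - g x) := by
  refine ⟨hf.contDiff.sub hg.contDiff, fun i hi x => ?_⟩
  have hi' : (i : WithTop ℕ∞) ≤ k := by exact_mod_cast hi
  have e : (fun x => f x - g x) = f - g := rfl
  rw [e, iteratedFDeriv_sub_apply (hf.contDiff.of_le hi').contDiffAt
    (hg.contDiff.of_le hi').contDiffAt, add_mul]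
  exact (norm_sub_le _ _).trans (add_le_add (hf.bound i hi x) (hg.bound i hi x))

theorem isSymbol_one {n : ℕ} (k : ℕ) : IsSymbol k 0 1 (fun _ : E n => (1 : ℂ)) := by
  refine ⟨contDiff_const, fun i _ x => ?_⟩
  have := bracket_pos x
  rcases Nat.eq_zero_or_pos i with rfl | hi
  · simp
  · rw [iteratedFDeriv_const_of_ne hi.ne', Pi.zero_apply, norm_zero]
    positivity

/-- The bump function equal to `1` for `|y| ≤ 1/2` and supported in `|y| < 3/4`. -/
def outerBump (n : ℕ) : ContDiffBump (0 : E n) := ⟨1 / 2, 3 / 4, by norm_num, by norm_num⟩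

/-- The function `outerBump`, as a complex-valued Schwartz function. -/
def cutoff (n : ℕ) : 𝓢(E n, ℂ) :=
  ((outerBump n).hasCompactSupport.comp_left (g := Complex.ofReal)
    Complex.ofReal_zero).toSchwartzMap
    (Complex.ofRealCLM.contDiff.comp (outerBump n).contDiff)

theorem cutoff_apply {n : ℕ} (y : E n) : cutoff n y = (outerBump n y : ℂ) := rfl

theorem cutoff_eq_one {n : ℕ} {y : E n} (hy : ‖y‖ ≤ 1 / 2) : cutoff n y = 1 := by
  rw [cutoff_apply, (outerBump n).one_of_mem_closedBall (by simpa [outerBump] using hy),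
    Complex.ofReal_one]

theorem tsupport_cutoff {n : ℕ} : tsupport (cutoff n) ⊆ Metric.closedBall (0 : E n) (3 / 4) := by
  have h : Function.support (cutoff n) ⊆ tsupport (outerBump n) := by
    intro y hy
    refine subset_tsupport _ fun h => hy ?_
    rw [cutoff_apply, h, Complex.ofReal_zero]
  have h2 := closure_minimal h (isClosed_tsupport _)
  rwa [(outerBump n).tsupport_eq] at h2

/-- The definition quantifies over all regularizers, so uniqueness needs one admissible `χ` to
exist; the cutoff is one. -/
theorem isOscIntegral_unique {n : ℕ} {φ : E n → ℝ} {a : E n → ℂ} {I I' : ℂ}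
    (h : IsOscIntegral φ a I) (h' : IsOscIntegral φ a I') : I = I' := by
  have h0 : cutoff n 0 = 1 := cutoff_eq_one (by simp)
  exact tendsto_nhds_unique (h _ h0).2 (h' _ h0).2

theorem quadOp_congr {n : ℕ} {A : Matrix (Fin n) (Fin n) ℝ} {f g : E n → ℂ} {x : E n}
    (h : f =ᶠ[𝓝 x] g) : quadOp A f =ᶠ[𝓝 x] quadOp A g := by
  have hD : ∀ {u v : E n → ℂ}, u =ᶠ[𝓝 x] v → ∀ j, Dop j u =ᶠ[𝓝 x] Dop j v := by
    intro u v huv j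
    filter_upwards [huv.eventuallyEq_nhds] with y hy
    unfold Dop pderiv
    rw [hy.fderiv_eq]
  have h2 : ∀ᶠ y in 𝓝 x, ∀ j k, Dop k (Dop j f) y = Dop k (Dop j g) y :=
    eventually_all.2 fun j => eventually_all.2 fun k => hD (hD h j) k
  filter_upwards [h2] with y hy
  simp only [quadOp, hy]

/-- The expansion depends only on the germ of the amplitude, so the cutoff does not alter it. -/
theorem quadOp_iterate_congr {n : ℕ} {A : Matrix (Fin n) (Fin n) ℝ} {f g : E n → ℂ} {x : E n}
    (h : f =ᶠ[𝓝 x] g) (j : ℕ) : (quadOp A)^[j] f =ᶠ[𝓝 x] (quadOp A)^[j] g := by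
  induction j with
  | zero => exact h
  | succ j ih =>
    simp only [Function.iterate_succ_apply']
    exact quadOp_congr ih

theorem quadOp_comp_add_right {n : ℕ} (A : Matrix (Fin n) (Fin n) ℝ) (f : E n → ℂ) (z : E n) :
    quadOp A (fun y => f (y + z)) = fun y => quadOp A f (y + z) := by
  have hD : ∀ (u : E n → ℂ) j, Dop j (fun y => u (y + z)) = fun y => Dop j u (y + z) := by
    intro u j
    funext y
    simp only [Dop, pderiv, fderiv_comp_add_right]
  funext y
  simp only [quadOp, hD]

theorem quadOp_iterate_comp_add_right {n : ℕ} (A : Matrix (Fin n) (Fin n) ℝ) (f : E n → ℂ)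
    (z : E n) (j : ℕ) :
    (quadOp A)^[j] (fun y => f (y + z)) = fun y => (quadOp A)^[j] f (y + z) := by
  induction j generalizing f with
  | zero => rfl
  | succ j ih => rw [Function.iterate_succ_apply, quadOp_comp_add_right, ih]; rfl

/-! ### From the seminorms of the statement to symbol estimates -/

section Amplitude

variable {n M N : ℕ} {x₀ : E n} {a : E n → ℂ}

/-- The constants in the growth condition are finite, so the sum can be used as a real number. -/
theorem weightedSupNormSum_ne_top (ha : IsAmplitude M N x₀ a) : weightedSupNormSum M x₀ a ≠ ⊤ := by
  refine ENNReal.sum_ne_top.2 fun α hα => ?_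
  obtain ⟨c, -, hc⟩ := ha.growth α ((mem_multiIndices α).1 hα)
  refine ne_top_of_le_ne_top (ENNReal.ofReal_ne_top (r := c)) (iSup_le fun x => ?_)
  refine ENNReal.ofReal_le_ofReal ?_
  rw [div_le_iff₀ (zpow_pos (bracket_pos x) _)]
  exact (hc x).le

theorem norm_mderiv_le_of_weightedSupNormSum (ha : IsAmplitude M N x₀ a) {α : Fin n → ℕ}
    (hα : order α ≤ M) (x : E n) :
    ‖mderiv α a (x - x₀)‖ ≤
      (weightedSupNormSum M x₀ a).toReal * bracket x ^ (2 * M - n - 1 - order α : ℝ) := by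
  have hb := bracket_pos x
  have e : bracket x ^ (2 * M - n - 1 - order α : ℝ) = bracket x ^ wexp M α := by
    rw [← Real.rpow_intCast, wexp]
    push_cast
    rfl
  rw [e, ← div_le_iff₀ (zpow_pos hb _), ← ENNReal.ofReal_le_iff_le_toReal
    (weightedSupNormSum_ne_top ha)]
  refine (le_iSup (fun x => ENNReal.ofReal (‖mderiv α a (x - x₀)‖ / bracket x ^ wexp M α))
    x).trans ?_
  exact Finset.single_le_sum (f := fun α => ⨆ x : E n,
    ENNReal.ofReal (‖mderiv α a (x - x₀)‖ / bracket x ^ wexp M α)) (fun _ _ => zero_le)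
    ((mem_multiIndices α).2 hα)

theorem norm_mderiv_le_of_supNormSum {K : ℕ} {S : Set (E n)} (hS : supNormSum K S a ≠ ⊤)
    {α : Fin n → ℕ} (hα : order α ≤ K) {x : E n} (hx : x ∈ S) :
    ‖mderiv α a x‖ ≤ (supNormSum K S a).toReal := by
  rw [← ENNReal.ofReal_le_iff_le_toReal hS]
  refine (le_iSup₂ (f := fun x (_ : x ∈ S) => ENNReal.ofReal ‖mderiv α a x‖) x hx).trans ?_
  exact Finset.single_le_sum (f := fun α => ⨆ x ∈ S, ENNReal.ofReal ‖mderiv α a x‖)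
    (fun _ _ => zero_le) ((mem_multiIndices α).2 hα)

/-- The growth condition concerns `a(x - x₀)`, whereas centring the phase requires `a(y + x₀)`. The
discrepancy is a translation by `2x₀`, paid for by Peetre's inequality; hence the dependence of the
constant on `x₀`. -/
theorem isSymbol_translate (hn : 0 < n) (ha : IsAmplitude M N x₀ a) :
    IsSymbol M (2 * M - n - 1)
      ((Real.sqrt 2 * bracket (x₀ + x₀)) ^ (|(2 * M - n - 1 : ℝ)| + M) *
        ((n : ℝ) ^ M * (weightedSupNormSum M x₀ a).toReal)) (fun y => a (y + x₀)) := by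
  have h : IsSymbol M (2 * M - n - 1) ((n : ℝ) ^ M * (weightedSupNormSum M x₀ a).toReal)
      (fun x => a (x - x₀)) := by
    refine ⟨ha.contDiff_weight.comp (contDiff_id.sub contDiff_const), fun i hi x => ?_⟩
    have hb := bracket_pos x
    rw [iteratedFDeriv_comp_sub]
    refine (norm_iteratedFDeriv_le_of_mderiv
      (c := (weightedSupNormSum M x₀ a).toReal * bracket x ^ (2 * M - n - 1 - i : ℝ))
      (ha.contDiff_weight.of_le (by exact_mod_cast hi)) fun α hα => by
        rw [← hα]
        exact norm_mderiv_le_of_weightedSupNormSum ha (hα.trans_le hi) x).trans ?_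
    rw [← mul_assoc]
    have hn1 : (1 : ℝ) ≤ n := by exact_mod_cast hn
    gcongr
  have h2 := h.comp_add_right (x₀ + x₀)
  refine ⟨?_, fun i hi x => ?_⟩
  · simpa [← add_assoc] using h2.contDiff
  · simpa [← add_assoc] using h2.bound i hi x

/-- Derivative bounds for the amplitude localized near the stationary point. -/
theorem exists_norm_iteratedFDeriv_cutoff_mul_le (hn : 0 < n) (K : ℕ) (x₀ : E n) :
    ∃ C : ℝ, 0 ≤ C ∧ ∀ a : E n → ℂ, ContDiff ℝ (K : WithTop ℕ∞) a →
      supNormSum K (Metric.ball x₀ 1) a ≠ ⊤ → ∀ p ≤ K, ∀ y : E n,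
        ‖iteratedFDeriv ℝ p (fun y => cutoff n y * a (y + x₀)) y‖ ≤
          C * (supNormSum K (Metric.ball x₀ 1) a).toReal := by
  obtain ⟨A, hA⟩ := exists_isSymbol_schwartz (cutoff n) K 0
  have hA0 := hA.nonneg
  refine ⟨2 ^ K * (A * (n : ℝ) ^ K), by positivity, fun a ha hS p hp y => ?_⟩
  set S := (supNormSum K (Metric.ball x₀ 1) a).toReal with hSdef
  have hS0 : 0 ≤ S := ENNReal.toReal_nonneg
  have hn1 : (1 : ℝ) ≤ n := by exact_mod_cast hn
  by_cases hy : y ∈ tsupport (cutoff n)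
  · have hy1 : ‖y‖ < 1 := by
      have := tsupport_cutoff hy
      rw [mem_closedBall_zero_iff] at this
      linarith
    have hb : ContDiff ℝ (K : WithTop ℕ∞) fun y => a (y + x₀) :=
      ha.comp (contDiff_id.add contDiff_const)
    refine (norm_iteratedFDeriv_mul_le ((cutoff n).smooth K) hb y (by exact_mod_cast hp)).trans ?_
    have h : ∀ i ∈ Finset.range (p + 1), (p.choose i : ℝ) * ‖iteratedFDeriv ℝ i (cutoff n) y‖ *
        ‖iteratedFDeriv ℝ (p - i) (fun y => a (y + x₀)) y‖ ≤
        (p.choose i : ℝ) * (A * ((n : ℝ) ^ K * S)) := by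
      intro i hi
      have hi' : i ≤ p := Nat.lt_succ_iff.1 (Finset.mem_range.1 hi)
      have h1 : ‖iteratedFDeriv ℝ i (cutoff n) y‖ ≤ A := by
        refine (hA.bound i (hi'.trans hp) y).trans (mul_le_of_le_one_right hA0 ?_)
        exact Real.rpow_le_one_of_one_le_of_nonpos (one_le_bracket y) (by simp)
      have h2 : ‖iteratedFDeriv ℝ (p - i) (fun y => a (y + x₀)) y‖ ≤ (n : ℝ) ^ K * S := by
        rw [iteratedFDeriv_comp_add_right]
        refine (norm_iteratedFDeriv_le_of_mderiv
          (ha.of_le (by exact_mod_cast (Nat.sub_le p i).trans hp)) fun α hα =>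
            norm_mderiv_le_of_supNormSum hS (by omega) (by
              rw [Metric.mem_ball, dist_eq_norm, add_sub_cancel_right]
              exact hy1)).trans ?_
        gcongr
        exact (Nat.sub_le p i).trans hp
      rw [mul_assoc]
      gcongr
    refine (Finset.sum_le_sum h).trans ?_
    rw [← Finset.sum_mul]
    have h2 : (∑ j ∈ Finset.range (p + 1), (p.choose j : ℝ)) = 2 ^ p := by
      exact_mod_cast Nat.sum_range_choose p
    rw [h2, mul_assoc, mul_assoc A]
    gcongr
    exact one_le_two
  · have h : y ∉ tsupport (fun y => cutoff n y * a (y + x₀)) :=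
      fun h => hy (closure_mono (Function.support_mul_subset_left _ _) h)
    have h2 : iteratedFDeriv ℝ p (fun y => cutoff n y * a (y + x₀)) y = 0 := by
      by_contra h3
      exact h (support_iteratedFDeriv_subset (𝕜 := ℝ) (n := p) h3)
    rw [h2, norm_zero]
    positivity

/-! ### Assembly of the near and far pieces -/

/-- The value of the oscillatory integral: the localized part is an absolutely convergent
integral, the remaining part is defined by integration by parts. -/
def oscValue (Q : Matrix (Fin n) (Fin n) ℝ) (M : ℕ) (x₀ : E n) (a : E n → ℂ) (lam : ℝ) : ℂ :=
  (∫ y, osc Q lam y * (cutoff n y * a (y + x₀))) +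
    ∫ y, osc Q lam y * (ibpOp Q lam)^[M] (fun y => (1 - cutoff n y) * a (y + x₀)) y

theorem isOscIntegral_oscValue (hn : 0 < n) {Q : Matrix (Fin n) (Fin n) ℝ} (hQ : Q.IsSymm)
    (hdet : Q.det ≠ 0) (ha : IsAmplitude M N x₀ a) {lam : ℝ} (hlam : 0 < lam) :
    IsOscIntegral (fun x => lam * phase Q x₀ x) a (oscValue Q M x₀ a lam) := by
  intro χ hχ
  have hb := isSymbol_translate hn ha
  have hosc1 := fun y => (norm_osc Q lam y).le
  obtain ⟨A, hA⟩ := exists_isSymbol_schwartz (cutoff n) M (-2 * M)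
  obtain ⟨A', hA'⟩ := exists_isSymbol_schwartz (cutoff n) M 0
  have hM := Nat.cast_nonneg (α := ℝ) M
  -- The convergence result is used for the near piece with `M = 0`: the cutoff, taken as a symbol
  -- of order `-2M`, brings the order down to `-n - 1`, and the iterate of `ibpOp` is the identity.
  have hf : IsSymbol 0 (2 * (0 : ℕ) - n - 1) _ fun y => cutoff n y * a (y + x₀) :=
    (hA.mul hb).mono (Nat.zero_le _) (by push_cast; linarith) le_rfl
  have hg : IsSymbol M (2 * M - n - 1) _ fun y => (1 - cutoff n y) * a (y + x₀) :=
    (((isSymbol_one M).sub hA').mul hb).mono le_rfl (by linarith) le_rfl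
  have hreg (ε : ℝ) (hε : 0 < ε) : ∃ c, IsSymbol M (-2 * M) c fun y => χ (ε • (y + x₀)) := by
    obtain ⟨c, hc⟩ := exists_isSymbol_schwartz χ M (-2 * M)
    obtain ⟨c', hc'⟩ := hc.comp_smul hε
    exact ⟨_, hc'.comp_add_right x₀⟩
  have hint {m c : ℝ} {h : E n → ℂ} (hh : IsSymbol 0 m c h) (hm : m ≤ 2 * M - n - 1) (ε : ℝ)
      (hε : 0 < ε) : Integrable fun y => osc Q lam y * (h y * χ (ε • (y + x₀))) := by
    obtain ⟨c', hc'⟩ := hreg ε hε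
    exact (hh.mul (hc'.mono (Nat.zero_le _) le_rfl le_rfl)).integrable_mul (by linarith)
      (continuous_osc Q lam) hosc1
  have hphase (x : E n) : Complex.exp (Complex.I * ((lam * phase Q x₀ (x + x₀) : ℝ) : ℂ)) =
      osc Q lam x := by rw [phase_add_right, osc]
  refine ⟨fun ε hε => ?_, ?_⟩
  · have h := (hint (hb.mono (Nat.zero_le _) le_rfl le_rfl) le_rfl ε hε).comp_add_right (-x₀)
    refine h.congr (Eventually.of_forall fun x => ?_)
    simp only [neg_add_cancel_right, ← hphase, mul_assoc]
  · have h1 := tendsto_integral_osc_mul_schwartz hdet hQ hlam hf (Or.inl rfl) x₀ χ hχ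
    -- The factor `1 - cutoff` vanishes for `|y| < 1/2`, which covers the region where the field
    -- fails to reproduce the phase.
    have h2 := tendsto_integral_osc_mul_schwartz hdet hQ hlam hg (Or.inr fun y hy => by
      rw [cutoff_eq_one hy.le, sub_self, zero_mul]) x₀ χ hχ
    refine (h1.add h2).congr' ?_
    filter_upwards [self_mem_nhdsWithin] with ε (hε : 0 < ε)
    rw [← integral_add (hint hf (by push_cast; linarith) ε hε)
      (hint (hg.mono (Nat.zero_le _) le_rfl le_rfl) le_rfl ε hε),
      ← integral_add_right_eq_self (fun x => Complex.exp
        (Complex.I * ((lam * phase Q x₀ x : ℝ) : ℂ)) * a x * χ (ε • x)) x₀]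
    congr 1
    funext y
    rw [hphase]
    ring

theorem exists_norm_oscValue_sub_expansion_le (hn : 0 < n) {Q : Matrix (Fin n) (Fin n) ℝ}
    (hQ : Q.IsSymm) (hdet : Q.det ≠ 0) (M N : ℕ) (x₀ : E n) :
    ∃ C : ℝ, 0 < C ∧ ∀ a : E n → ℂ, IsAmplitude M N x₀ a → ∀ lam : ℝ, 0 < lam →
      ENNReal.ofReal ‖oscValue Q M x₀ a lam - expansion Q hQ N x₀ a lam‖ ≤
        ENNReal.ofReal (C * lam ^ (-((n : ℝ) / 2) - (N : ℝ) - 1)) *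
            supNormSum (n + 2 * N + 3) (Metric.ball x₀ 1) a +
          ENNReal.ofReal (C * lam ^ (-(M : ℝ))) * weightedSupNormSum M x₀ a := by
  obtain ⟨C₁, hC₁, h₁⟩ := exists_stationary_phase hQ hdet N
  obtain ⟨C₂, hC₂, h₂⟩ := exists_norm_integral_osc_ibpOp_le hdet M
  obtain ⟨C₃, hC₃, h₃⟩ := exists_norm_iteratedFDeriv_cutoff_mul_le hn (n + 2 * N + 3) x₀
  obtain ⟨A, hA⟩ := exists_isSymbol_schwartz (cutoff n) M 0
  set P : ℝ := (Real.sqrt 2 * bracket (x₀ + x₀)) ^ (|(2 * M - n - 1 : ℝ)| + M) with hP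
  have hbx := bracket_pos (x₀ + x₀)
  have hA0 := hA.nonneg
  set C₄ : ℝ := 2 ^ M * ((1 + A) * (P * (n : ℝ) ^ M)) with hC₄
  -- The `1` makes the constant strictly positive, so that an infinite supremum gives an infinite
  -- right-hand side instead of `0 * ⊤ = 0`.
  refine ⟨C₁ * C₃ + C₂ * C₄ + 1, by positivity, fun a ha lam hlam => ?_⟩
  set C : ℝ := C₁ * C₃ + C₂ * C₄ + 1 with hC
  have hCpos : 0 < C := by positivity
  have hl1 : 0 < lam ^ (-((n : ℝ) / 2) - (N : ℝ) - 1) := Real.rpow_pos_of_pos hlam _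
  have hl2 : 0 < lam ^ (-(M : ℝ)) := Real.rpow_pos_of_pos hlam _
  by_cases hS : supNormSum (n + 2 * N + 3) (Metric.ball x₀ 1) a = ⊤
  · rw [hS, ENNReal.mul_top (ENNReal.ofReal_pos.2 (by positivity)).ne', top_add]
    exact le_top
  have hW := weightedSupNormSum_ne_top ha
  set S := (supNormSum (n + 2 * N + 3) (Metric.ball x₀ 1) a).toReal with hSdef
  set W := (weightedSupNormSum M x₀ a).toReal with hWdef
  have hS0 : 0 ≤ S := ENNReal.toReal_nonneg
  have hW0 : 0 ≤ W := ENNReal.toReal_nonneg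
  rw [← ENNReal.ofReal_toReal hS, ← ENNReal.ofReal_toReal hW, ← ENNReal.ofReal_mul (by positivity),
    ← ENNReal.ofReal_mul (by positivity), ← ENNReal.ofReal_add (by positivity) (by positivity)]
  refine ENNReal.ofReal_le_ofReal ?_
  have hts : tsupport (fun y => cutoff n y * a (y + x₀)) ⊆ Metric.closedBall 0 1 :=
    ((closure_mono (Function.support_mul_subset_left _ _)).trans tsupport_cutoff).trans
      (Metric.closedBall_subset_closedBall (by norm_num))
  have hloc : (fun y => cutoff n y * a (y + x₀)) =ᶠ[𝓝 0] fun y => a (y + x₀) := by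
    filter_upwards [Metric.closedBall_mem_nhds (0 : E n) (ε := 1 / 2) (by norm_num)] with y hy
    rw [cutoff_eq_one (by simpa using hy), one_mul]
  have hnear := h₁ (fun y => cutoff n y * a (y + x₀)) (C₃ * S)
    (((cutoff n).smooth _).mul (ha.contDiff_expansion.comp (contDiff_id.add contDiff_const)))
    hts (h₃ a ha.contDiff_expansion hS) lam hlam
  have hexp : statConst Q hQ lam * ∑ j ∈ Finset.range (N + 1),
      (((lam : ℂ) ^ j)⁻¹ / (Nat.factorial j : ℂ)) *
        ((quadOp Q⁻¹)^[j] fun y => cutoff n y * a (y + x₀)) 0 = expansion Q hQ N x₀ a lam := by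
    have (j : ℕ) : ((quadOp Q⁻¹)^[j] fun y => cutoff n y * a (y + x₀)) 0 =
        (quadOp Q⁻¹)^[j] a x₀ := by
      rw [(quadOp_iterate_congr hloc j).eq_of_nhds, quadOp_iterate_comp_add_right]
      exact congrArg _ (zero_add x₀)
    simp only [this]
    rfl
  rw [hexp] at hnear
  have hg : IsSymbol M (2 * M - n - 1) (C₄ * W) fun y => (1 - cutoff n y) * a (y + x₀) :=
    (((isSymbol_one M).sub hA).mul (isSymbol_translate hn ha)).mono le_rfl (by linarith)
      (le_of_eq (by rw [hC₄, hP, hWdef]; ring))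
  have hfar := h₂ lam hlam _ _ hg
  rw [oscValue, add_sub_right_comm]
  refine (norm_add_le _ _).trans (add_le_add (hnear.trans ?_) (hfar.trans ?_))
  · have : C₁ * C₃ ≤ C := by rw [hC]; linarith [show 0 ≤ C₂ * C₄ by positivity]
    calc _ = C₁ * C₃ * lam ^ (-((n : ℝ) / 2) - (N : ℝ) - 1) * S := by ring
      _ ≤ _ := by gcongr
  · have : C₂ * C₄ ≤ C := by rw [hC]; linarith [show 0 ≤ C₁ * C₃ by positivity]
    calc _ = C₂ * C₄ * lam ^ (-(M : ℝ)) * W := by ring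
      _ ≤ _ := by gcongr

theorem supNormSum_mono {K : ℕ} {S T : Set (E n)} (h : S ⊆ T) (a : E n → ℂ) :
    supNormSum K S a ≤ supNormSum K T a :=
  Finset.sum_le_sum fun _ _ => biSup_mono h

/-- For `|α| ≤ M` and `M ≥ n + 1` the exponent `2M - n - 1 - |α|` is nonnegative, so dividing by the
weight only decreases. -/
theorem weightedSupNormSum_le_supNormSum {K : ℕ} (hM : n + 1 ≤ M) (hMK : M ≤ K) (x₀ : E n)
    (a : E n → ℂ) : weightedSupNormSum M x₀ a ≤ supNormSum K Set.univ a := by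
  have hsub : multiIndices n M ⊆ multiIndices n K := fun α hα =>
    (mem_multiIndices α).2 (((mem_multiIndices α).1 hα).trans hMK)
  refine le_trans (Finset.sum_le_sum fun α hα => iSup_le fun x => ?_)
    (Finset.sum_le_sum_of_subset hsub)
  have hα' := (mem_multiIndices α).1 hα
  have h1 : 1 ≤ bracket x ^ wexp M α := by
    refine one_le_zpow₀ (one_le_bracket x) ?_
    unfold wexp
    omega
  refine le_trans (ENNReal.ofReal_le_ofReal (div_le_self (norm_nonneg _) h1)) ?_
  exact le_iSup₂ (f := fun x (_ : x ∈ (Set.univ : Set (E n))) => ENNReal.ofReal ‖mderiv α a x‖)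
    (x - x₀) (Set.mem_univ _)

end Amplitude

end StatPhase

end

/-! ### The theorem -/

theorem lemma1 (n : ℕ) (hn : 0 < n) (M N : ℕ) (x₀ : StatPhase.E n)
    (Q : Matrix (Fin n) (Fin n) ℝ) (hQsymm : Q.IsSymm) (hQdet : Q.det ≠ 0) :
    -- the oscillatory integral is well-defined
    (∀ a : ℝ → StatPhase.E n → ℂ,
      (∀ lam : ℝ, 0 < lam → StatPhase.IsAmplitude M N x₀ (a lam)) →
      ∀ lam : ℝ, 0 < lam →
        ∃! I : ℂ, StatPhase.IsOscIntegral (fun x => lam * StatPhase.phase Q x₀ x) (a lam) I) ∧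
    -- the expansion with the two error terms
    (∃ C : ℝ, 0 < C ∧ ∀ a : ℝ → StatPhase.E n → ℂ,
      (∀ lam : ℝ, 0 < lam → StatPhase.IsAmplitude M N x₀ (a lam)) →
      ∀ lam : ℝ, 1 ≤ lam → ∀ I : ℂ,
        StatPhase.IsOscIntegral (fun x => lam * StatPhase.phase Q x₀ x) (a lam) I →
        ENNReal.ofReal ‖I - StatPhase.expansion Q hQsymm N x₀ (a lam) lam‖ ≤
          ENNReal.ofReal (C * lam ^ (-((n : ℝ) / 2) - (N : ℝ) - 1)) *
              StatPhase.supNormSum (n + 2 * N + 3) (Metric.ball x₀ 1) (a lam) +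
            ENNReal.ofReal (C * lam ^ (-(M : ℝ))) *
              StatPhase.weightedSupNormSum M x₀ (a lam)) ∧
    -- the simplified expansion for `M` in the stated interval
    (max (⌈(n : ℝ) / 2⌉₊ + N + 1) (n + 1) ≤ M → M ≤ n + 2 * N + 3 →
      ∃ C : ℝ, 0 < C ∧ ∀ a : ℝ → StatPhase.E n → ℂ,
        (∀ lam : ℝ, 0 < lam → StatPhase.IsAmplitude M N x₀ (a lam)) →
        ∀ lam : ℝ, 1 ≤ lam → ∀ I : ℂ,
          StatPhase.IsOscIntegral (fun x => lam * StatPhase.phase Q x₀ x) (a lam) I →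
          ENNReal.ofReal ‖I - StatPhase.expansion Q hQsymm N x₀ (a lam) lam‖ ≤
            ENNReal.ofReal (C * lam ^ (-((n : ℝ) / 2) - (N : ℝ) - 1)) *
              StatPhase.supNormSum (n + 2 * N + 3) Set.univ (a lam)) := by
  have hex := StatPhase.exists_norm_oscValue_sub_expansion_le hn hQsymm hQdet M N x₀
  obtain ⟨C, hC, h⟩ := hex
  refine ⟨fun a ha lam hlam => ?_, ⟨C, hC, fun a ha lam hlam I hI => ?_⟩,
    fun hM1 hM2 => ⟨2 * C, by positivity, fun a ha lam hlam I hI => ?_⟩⟩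
  · exact ⟨_, StatPhase.isOscIntegral_oscValue hn hQsymm hQdet (ha lam hlam) hlam,
      fun I hI => StatPhase.isOscIntegral_unique hI
        (StatPhase.isOscIntegral_oscValue hn hQsymm hQdet (ha lam hlam) hlam)⟩
  · have hlam0 : 0 < lam := by linarith
    rw [StatPhase.isOscIntegral_unique hI
      (StatPhase.isOscIntegral_oscValue hn hQsymm hQdet (ha lam hlam0) hlam0)]
    exact h (a lam) (ha lam hlam0) lam hlam0
  · have hlam0 : 0 < lam := by linarith
    rw [StatPhase.isOscIntegral_unique hI
      (StatPhase.isOscIntegral_oscValue hn hQsymm hQdet (ha lam hlam0) hlam0)]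
    refine (h (a lam) (ha lam hlam0) lam hlam0).trans ?_
    have hMn : n + 1 ≤ M := (le_max_right _ _).trans hM1
    have hMN : (n : ℝ) / 2 + N + 1 ≤ M := by
      have h1 : ((⌈(n : ℝ) / 2⌉₊ + N + 1 : ℕ) : ℝ) ≤ M := by
        exact_mod_cast (le_max_left _ _).trans hM1
      push_cast at h1
      linarith [Nat.le_ceil ((n : ℝ) / 2)]
    -- Here `λ ≥ 1` enters: `M ≥ n/2 + N + 1` lets the far error be absorbed into the near one, and
    -- the constant `2 * C` pays for the two terms.
    have hpow : lam ^ (-(M : ℝ)) ≤ lam ^ (-((n : ℝ) / 2) - (N : ℝ) - 1) :=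
      Real.rpow_le_rpow_of_exponent_le hlam (by linarith)
    have hp : 0 < lam ^ (-((n : ℝ) / 2) - (N : ℝ) - 1) := Real.rpow_pos_of_pos hlam0 _
    rw [mul_assoc 2 C, two_mul (C * _), ENNReal.ofReal_add (by positivity) (by positivity),
      add_mul]
    gcongr
    · exact StatPhase.supNormSum_mono (Set.subset_univ _) _
    · exact StatPhase.weightedSupNormSum_le_supNormSum hMn hM2 x₀ _
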